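/- Let $F$ be a field, let $n\ge 1$ be an integer, and let $\mathbb P^1=\mathbb P^1_F=\operatorname{Proj}F[x_0,x_1]$ over $\operatorname{Spec}F$, with Serre's twisting sheaves $\mathcal O(d)$, $d\in\mathbb Z$. Let $\mathcal I$ be the ideal sheaf of the diagonal in $\mathbb P^1\times_F\mathbb P^1$, let $X^1$ be the first-order infinitesimal neighbourhood of the diagonal, i.e. the closed subscheme of $\mathbb P^1\times_F\mathbb P^1$ with structure sheaf $\mathcal O_{\Delta^1}=\mathcal O_{\mathbb P^1\times\mathbb P^1}/\mathcal I^{2}$, and let $p,q:X^1\to\mathbb P^1$ be the first and the second projection. They coincide as maps of topological spaces, so $p_*$ and $q_*$ put two $\mathcal O_{\mathbb P^1}$-module structures on one sheaf of abelian groups, the first-order principal parts of $\mathcal O(n)$: $$\mathcal P^1(\mathcal O(n))=p_*q^*\mathcal O(n)\ \text{ (left module)},\qquad \mathcal P^1(\mathcal O(n))=q_*q^*\mathcal O(n)\ \text{ (right module)},$$ where $q^*\mathcal O(n)$ on $X^1$ is the tensor product of $\mathcal O_{\Delta^1}$ with the pullback of $\mathcal O(n)$ to $\mathbb P^1\times_F\mathbb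 P^1$ along the second projection. Then $\mathcal P^1(\mathcal O(n))$ is locally free both as a left and as a right $\mathcal O_{\mathbb P^1}$-module, and the following hold. 1. As a right $\mathcal O_{\mathbb P^1}$-module, $\mathcal P^1(\mathcal O(n))\cong\mathcal O(n)\oplus\mathcal O(n-2)$ (in every characteristic). 2. If the characteristic of $F$ does not divide $n$, then as a left $\mathcal O_{\mathbb P^1}$-module $\mathcal P^1(\mathcal O(n))\cong\mathcal O(n-1)\oplus\mathcal O(n-1)$. 3. If the characteristic of $F$ divides $n$, then as a left $\mathcal O_{\mathbb P^1}$-module $\mathcal P^1(\mathcal O(n))\cong\mathcal O(n)\oplus\mathcal O(n-2)$. (In characteristic $0$ the characteristic does not divide $n$, as $n\ge1$.) -/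

import Mathlib

open AlgebraicGeometry CategoryTheory CategoryTheory.Limits TopologicalSpace Opposite

universe u

noncomputable section

namespace PrincipalParts

/-! ### The twisting sheaves `O(d)` on `Proj` of a graded ring

The construction is the one used for the structure sheaf: a section of `O(d)` over `U` is a
function on `U` with values in the localizations that is locally a fraction `r / s` of homogeneous
elements with `deg r - deg s = d`. -/

section TwistingSheaf

variable {A σ : Type u} [CommRing A] [SetLike σ A] [AddSubgroupClass σ A]
variable (𝒜 : ℕ → σ) [GradedRing 𝒜] (d : ℤ)

/-- The localization `A_x` of the graded ring at a homogeneous prime `x`. The fractions of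
homogeneous elements of degree `0` in it form the homogeneous localization at `x`. -/
abbrev LocalizationAt (x : ProjectiveSpectrum 𝒜) : Type u :=
  Localization.AtPrime x.asHomogeneousIdeal.toIdeal

/-- `f` is given on all of `U` by one fraction `r / s` of homogeneous elements with
`deg r - deg s = d`. -/
def IsTwistedFraction {U : Opens (ProjectiveSpectrum.top 𝒜)}
    (f : ∀ x : U, LocalizationAt 𝒜 x.1) : Prop :=
  ∃ (i j : ℕ) (_ : (i : ℤ) = j + d) (r : 𝒜 i) (s : 𝒜 j)
    (s_nin : ∀ x : U, s.1 ∉ x.1.asHomogeneousIdeal),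
    ∀ x : U, f x = Localization.mk r.1 ⟨s.1, s_nin x⟩

/-- Being a fraction of degree `d` is stable under restriction. -/
def isTwistedFractionPrelocal :
    TopCat.PrelocalPredicate fun x : ProjectiveSpectrum.top 𝒜 => LocalizationAt 𝒜 x where
  pred f := IsTwistedFraction 𝒜 d f
  res := by
    rintro V U i f ⟨a, b, hab, r, s, h, w⟩
    exact ⟨a, b, hab, r, s, (h <| i ·), (w <| i ·)⟩

/-- Being locally a fraction of homogeneous elements of degree `d`. -/
def isLocallyTwistedFraction :
    TopCat.LocalPredicate fun x : ProjectiveSpectrum.top 𝒜 => LocalizationAt 𝒜 x :=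
  (isTwistedFractionPrelocal 𝒜 d).sheafify

/-- `O(d)` as a sheaf of sets. -/
def twistInType : TopCat.Sheaf (Type u) (ProjectiveSpectrum.top 𝒜) :=
  TopCat.subsheafToTypes (isLocallyTwistedFraction 𝒜 d)

/-- At every point there are homogeneous elements of arbitrarily large degree that do not vanish. -/
theorem exists_homogeneous_notMem (x : ProjectiveSpectrum 𝒜) (N : ℕ) :
    ∃ (j : ℕ) (s : 𝒜 j), N ≤ j ∧ s.1 ∉ x.asHomogeneousIdeal := by
  obtain ⟨s, m, s_deg, hm, hx⟩ :
      ∃ (s : A) (m : ℕ) (_ : s ∈ 𝒜 m) (_ : 0 < m), s ∉ x.asHomogeneousIdeal := by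
    classical
    by_contra! h
    refine x.not_irrelevant_le fun z hz => ?_
    rw [← DirectSum.sum_support_decompose 𝒜 z]
    refine x.asHomogeneousIdeal.toIdeal.sum_mem fun k _ => ?_
    rcases Nat.eq_zero_or_pos k with rfl | hk
    · have h0 : (DirectSum.decompose 𝒜 z 0 : A) = 0 := by
        have := (HomogeneousIdeal.mem_irrelevant_iff 𝒜 z).1 hz
        simpa [GradedRing.proj_apply] using this
      rw [h0]
      exact zero_mem _
    · exact h _ k (SetLike.coe_mem _) hk
  refine ⟨N • m, ⟨s ^ N, SetLike.pow_mem_graded N s_deg⟩, ?_, fun h => hx ?_⟩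
  · simpa using Nat.le_mul_of_pos_right N hm
  · exact x.isPrime.mem_of_pow_mem N h

theorem twist_zero_mem (U : Opens (ProjectiveSpectrum.top 𝒜)) :
    (isLocallyTwistedFraction 𝒜 d).pred (0 : ∀ x : U, LocalizationAt 𝒜 x.1) := fun x => by
  obtain ⟨j, s, hj, hs⟩ := exists_homogeneous_notMem 𝒜 x.1 d.natAbs
  refine ⟨U ⊓ ProjectiveSpectrum.basicOpen 𝒜 s.1, ⟨x.2, hs⟩, Opens.infLELeft _ _,
    (j + d).toNat, j, by omega, 0, s, fun y => y.2.2, fun y => ?_⟩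
  exact (Localization.mk_zero _).symm

theorem twist_add_mem (U : Opens (ProjectiveSpectrum.top 𝒜)) (a b : ∀ x : U, LocalizationAt 𝒜 x.1)
    (ha : (isLocallyTwistedFraction 𝒜 d).pred a) (hb : (isLocallyTwistedFraction 𝒜 d).pred b) :
    (isLocallyTwistedFraction 𝒜 d).pred (a + b) := fun x => by
  obtain ⟨Va, ma, ia, na, ja, ea, ⟨ra, hra⟩, ⟨sa, hsa⟩, ka, wa⟩ := ha x
  obtain ⟨Vb, mb, ib, nb, jb, eb, ⟨rb, hrb⟩, ⟨sb, hsb⟩, kb, wb⟩ := hb x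
  have e : na + jb = nb + ja := by omega
  refine ⟨Va ⊓ Vb, ⟨ma, mb⟩, Opens.infLELeft _ _ ≫ ia, na + jb, ja + jb, by push_cast; omega,
    ⟨sa * rb + sb * ra, ?_⟩, ⟨sa * sb, SetLike.mul_mem_graded hsa hsb⟩, fun y => ?_, fun y => ?_⟩
  · refine add_mem ?_ ?_
    · rw [e, add_comm]
      exact SetLike.mul_mem_graded hsa hrb
    · rw [add_comm]
      exact SetLike.mul_mem_graded hsb hra
  · exact fun h => (ProjectiveSpectrum.isPrime y.1).mem_or_mem h |>.elim
      (ka ⟨y.1, y.2.1⟩) (kb ⟨y.1, y.2.2⟩)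
  · have h1 := wa ⟨y.1, y.2.1⟩
    have h2 := wb ⟨y.1, y.2.2⟩
    refine (congrArg₂ (· + ·) h1 h2).trans ?_
    exact Localization.add_mk _ _ _ _

theorem twist_neg_mem (U : Opens (ProjectiveSpectrum.top 𝒜)) (a : ∀ x : U, LocalizationAt 𝒜 x.1)
    (ha : (isLocallyTwistedFraction 𝒜 d).pred a) :
    (isLocallyTwistedFraction 𝒜 d).pred (-a) := fun x => by
  obtain ⟨V, m, i, n, j, e, ⟨r, hr⟩, s, k, w⟩ := ha x
  refine ⟨V, m, i, n, j, e, ⟨-r, neg_mem hr⟩, s, k, fun y => ?_⟩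
  exact (congrArg Neg.neg (w y)).trans (Localization.neg_mk _ _)

/-- The sections of `O(d)` over `U`. -/
def twistSections (U : (Opens (ProjectiveSpectrum.top 𝒜))ᵒᵖ) :
    AddSubgroup (∀ x : U.unop, LocalizationAt 𝒜 x.1) where
  carrier := {f | (isLocallyTwistedFraction 𝒜 d).pred f}
  zero_mem' := twist_zero_mem 𝒜 d _
  add_mem' := twist_add_mem 𝒜 d _ _ _
  neg_mem' := twist_neg_mem 𝒜 d _ _

theorem twist_smul_mem (U : Opens (ProjectiveSpectrum.top 𝒜))
    (g : (ProjectiveSpectrum.Proj.structureSheaf 𝒜).1.obj (op U))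
    (a : ∀ x : U, LocalizationAt 𝒜 x.1) (ha : (isLocallyTwistedFraction 𝒜 d).pred a) :
    (isLocallyTwistedFraction 𝒜 d).pred
      (fun x : U => HomogeneousLocalization.val (g.1 x) * a x) := fun x => by
  obtain ⟨Va, ma, ia, n, ⟨ra, hra⟩, ⟨sa, hsa⟩, ka, wa⟩ := g.2 x
  obtain ⟨Vb, mb, ib, nb, jb, eb, ⟨rb, hrb⟩, ⟨sb, hsb⟩, kb, wb⟩ := ha x
  refine ⟨Va ⊓ Vb, ⟨ma, mb⟩, Opens.infLELeft _ _ ≫ ia, n + nb, n + jb, by push_cast; omega,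
    ⟨ra * rb, SetLike.mul_mem_graded hra hrb⟩, ⟨sa * sb, SetLike.mul_mem_graded hsa hsb⟩,
    fun y => ?_, fun y => ?_⟩
  · exact fun h => (ProjectiveSpectrum.isPrime y.1).mem_or_mem h |>.elim
      (ka ⟨y.1, y.2.1⟩) (kb ⟨y.1, y.2.2⟩)
  · have h1 := congrArg HomogeneousLocalization.val (wa ⟨y.1, y.2.1⟩)
    have h2 := wb ⟨y.1, y.2.2⟩
    refine (congrArg₂ (· * ·) h1 h2).trans ?_
    exact Localization.mk_mul _ _ _ _

/-- `O(d)` as a presheaf of abelian groups. -/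
def twistInAb : TopCat.Presheaf Ab.{u} (ProjectiveSpectrum.top 𝒜) where
  obj U := AddCommGrpCat.of (twistSections 𝒜 d U)
  map i := AddCommGrpCat.ofHom
    { toFun := (twistInType 𝒜 d).1.map i
      map_zero' := rfl
      map_add' := fun _ _ => rfl }

/-- A section of the structure sheaf multiplies a section of `O(d)` pointwise. -/
instance twistModule (U : (Opens (ProjectiveSpectrum.top 𝒜))ᵒᵖ) :
    Module ((ProjectiveSpectrum.Proj.structureSheaf 𝒜).1.obj U) (twistSections 𝒜 d U) where
  smul g a := ⟨fun x => HomogeneousLocalization.val (g.1 x) * a.1 x,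
    twist_smul_mem 𝒜 d U.unop g a.1 a.2⟩
  one_smul a := Subtype.ext (funext fun x => by
    change HomogeneousLocalization.val 1 * a.1 x = a.1 x
    rw [HomogeneousLocalization.val_one, one_mul])
  mul_smul g h a := Subtype.ext (funext fun x => by
    change HomogeneousLocalization.val (g.1 x * h.1 x) * a.1 x = _ * (_ * a.1 x)
    rw [HomogeneousLocalization.val_mul, mul_assoc])
  smul_zero g := Subtype.ext (funext fun x => mul_zero _)
  smul_add g a b := Subtype.ext (funext fun x => mul_add _ _ _)
  add_smul g h a := Subtype.ext (funext fun x => by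
    change HomogeneousLocalization.val (g.1 x + h.1 x) * a.1 x = _ * a.1 x + _ * a.1 x
    rw [HomogeneousLocalization.val_add, add_mul])
  zero_smul a := Subtype.ext (funext fun x => by
    change HomogeneousLocalization.val 0 * a.1 x = 0
    rw [HomogeneousLocalization.val_zero, zero_mul])

instance (U : (Opens (Proj 𝒜))ᵒᵖ) :
    Module ((Proj 𝒜).ringCatSheaf.obj.obj U) ((twistInAb 𝒜 d).obj U) :=
  twistModule 𝒜 d U

/-- Serre's twisting sheaf `O(d)` on `Proj 𝒜`, as a sheaf of modules. -/
def twist : (Proj 𝒜).Modules where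
  val := PresheafOfModules.ofPresheaf (R := (Proj 𝒜).ringCatSheaf.obj) (twistInAb 𝒜 d)
    fun _ _ _ _ _ => rfl
  isSheaf := (TopCat.Presheaf.isSheaf_iff_isSheaf_comp (forget AddCommGrpCat) _).2
    (twistInType 𝒜 d).2

end TwistingSheaf

/-! ### Principal parts -/

section PrincipalParts

variable {X S : Scheme.{u}} (f : X ⟶ S) (k : ℕ) (E : X.Modules)

/-- The `k`-th order infinitesimal neighbourhood `X^k` of the diagonal of `X` over `S`: the closed
subscheme of `X ×_S X` with structure sheaf `O / I ^ (k + 1)`, where `I` is the ideal sheaf of the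
diagonal. Used for `X` separated over `S`. -/
def diagonalNeighborhood : Scheme.{u} :=
  ((pullback.diagonal f).ker ^ (k + 1)).subscheme

/-- The closed immersion of `X^k` into `X ×_S X`. -/
def diagonalNeighborhoodι : diagonalNeighborhood f k ⟶ pullback f f :=
  ((pullback.diagonal f).ker ^ (k + 1)).subschemeι

/-- The first projection `p : X^k ⟶ X`. -/
def firstProj : diagonalNeighborhood f k ⟶ X :=
  diagonalNeighborhoodι f k ≫ pullback.fst f f

/-- The second projection `q : X^k ⟶ X`. -/
def secondProj : diagonalNeighborhood f k ⟶ X :=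
  diagonalNeighborhoodι f k ≫ pullback.snd f f

/-- The module underlying the principal parts of `E`, on `X^k`: the inverse image of `E` under the
second projection. This is the restriction to `X^k` of the inverse image of `E` on `X ×_S X`, that
is, the tensor product of the latter with the structure sheaf of `X^k`. -/
def principalPartsOnNeighborhood : (diagonalNeighborhood f k).Modules :=
  (Scheme.Modules.pullback (secondProj f k)).obj E

/-- The sheaf of `k`-th order principal parts of `E` with its left `O_X`-module structure,
`p_* (O_{X^k} ⊗ q^* E)`. -/
def leftPrincipalParts : X.Modules :=
  (Scheme.Modules.pushforward (firstProj f k)).obj (principalPartsOnNeighborhood f k E)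

/-- The sheaf of `k`-th order principal parts of `E` with its right `O_X`-module structure,
`q_* (O_{X^k} ⊗ q^* E)`. -/
def rightPrincipalParts : X.Modules :=
  (Scheme.Modules.pushforward (secondProj f k)).obj (principalPartsOnNeighborhood f k E)

/-- The two projections agree as maps of topological spaces. Hence the left and the right principal
parts are two module structures on one sheaf of abelian groups. -/
theorem firstProj_base_eq [IsSeparated f] : (firstProj f k).base = (secondProj f k).base := by
  ext x
  have hr : Set.range (diagonalNeighborhoodι f k) = Set.range (pullback.diagonal f) := by
    have h1 := Scheme.IdealSheafData.range_subschemeι ((pullback.diagonal f).ker ^ (k + 1))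
    rw [Scheme.IdealSheafData.support_pow _ _ (by omega), Scheme.Hom.support_ker] at h1
    exact h1.trans (pullback.diagonal f).isClosedEmbedding.isClosed_range.closure_eq
  have h : diagonalNeighborhoodι f k x ∈ Set.range (pullback.diagonal f) :=
    hr ▸ Set.mem_range_self x
  obtain ⟨y, hy⟩ := h
  change pullback.fst f f (diagonalNeighborhoodι f k x) =
    pullback.snd f f (diagonalNeighborhoodι f k x)
  rw [← hy, ← Scheme.Hom.comp_apply, ← Scheme.Hom.comp_apply]
  simp

end PrincipalParts

/-! ### The projective line -/

section ProjectiveLine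

attribute [local instance] MvPolynomial.gradedAlgebra

variable (F : Type u) [Field F]

/-- `P¹_F = Proj F[x₀, x₁]`. -/
def projectiveLine : Scheme.{u} :=
  Proj (MvPolynomial.homogeneousSubmodule (Fin 2) F)

/-- The structure morphism `P¹_F ⟶ Spec F`. -/
def projectiveLineToSpec : projectiveLine F ⟶ Spec (.of F) :=
  Proj.toSpecZero (MvPolynomial.homogeneousSubmodule (Fin 2) F) ≫
    Spec.map (CommRingCat.ofHom
      (algebraMap F (MvPolynomial.homogeneousSubmodule (Fin 2) F 0)))

/-- The projective line is separated over the base field. -/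
instance : IsSeparated (projectiveLineToSpec F) := by
  unfold projectiveLineToSpec
  have h1 : IsSeparated (Proj.toSpecZero (MvPolynomial.homogeneousSubmodule (Fin 2) F)) :=
    Proj.isSeparated _
  have h2 : IsSeparated (Spec.map (CommRingCat.ofHom
      (algebraMap F (MvPolynomial.homogeneousSubmodule (Fin 2) F 0)))) := inferInstance
  exact @IsSeparated.instCompScheme _ _ _ _ _ h1 h2

/-- The sheaf `O(d)` on `P¹_F`. -/
def lineTwist (d : ℤ) : (projectiveLine F).Modules :=
  twist (MvPolynomial.homogeneousSubmodule (Fin 2) F) d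

/-- `Pr^k(O(d))` on `P¹_F` as a left module. -/
def lineLeftParts (k : ℕ) (d : ℤ) : (projectiveLine F).Modules :=
  leftPrincipalParts (projectiveLineToSpec F) k (lineTwist F d)

/-- `Pr^k(O(d))` on `P¹_F` as a right module. -/
def lineRightParts (k : ℕ) (d : ℤ) : (projectiveLine F).Modules :=
  rightPrincipalParts (projectiveLineToSpec F) k (lineTwist F d)

end ProjectiveLine

/-- Locally free sheaves of modules on a scheme. -/
def IsLocallyFree {X : Scheme.{u}} (E : X.Modules) : Prop :=
  SheafOfModules.IsLocallyFree (R := X.ringCatSheaf) E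

end PrincipalParts

end

/-!
Over a chart of the projective line with ring of functions `A = F[t]`, the neighbourhood `X^1` is the
spectrum of `(A ⊗ A) / I ^ 2`, where `I` is the kernel of the multiplication. Write `T = 1 ⊗ t`,
`τ = t ⊗ 1` and `dt = T - τ`. Then `dt ^ 2 = 0`, and `1`, `dt` is a basis of the functions on `X^1`
through the left as well as through the right embedding of `A` (`bijective_leftHom`,
`bijective_rightHom`). The Taylor expansion `f ↦ f + f' ε` shows that `1`, `dt` are independent over
the left factor (`bijective_principalParts`).

The inverse image of `O(n)` under the second projection is free on `e₀ = 1 ⊗ x₀ ^ n` and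
`e₁ = 1 ⊗ x₁ ^ n` over the charts `x₀ ≠ 0` and `x₁ ≠ 0`. With `t = x₁ / x₀` and `s = t⁻¹` the
transition functions on the overlap are `e₁ = T ^ n e₀` and `ds = - dt / (τ T)`, and
`T ^ n = τ ^ (n - 1) (τ + n dt)`. Since `τ dt = T dt`, the second basis vectors `dt e₀`, `- ds e₁`
always transform by the `(n - 2)`-nd power of the coordinate.

* From the right, `e₁ = T ^ n e₀` is the transition function of `O(n)`, which gives
  `O(n) ⊕ O(n - 2)` (`rightParts_iso`).
* From the left, if `n = 0` in `F`, then `T ^ n = τ ^ n`, and the result is the same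
  (`leftParts_iso_of_natCast_eq_zero`).
* From the left, if `n` is invertible in `F`, then `(τ + n dt) e₀`, `e₀` and `e₁`, `(τ⁻¹ + n ds) e₁`
  are bases over the two charts. The formula for `T ^ n`, and the same formula for `T⁻¹`, say that
  both vectors transform by `τ ^ (n - 1)`, which gives `O(n - 1) ⊕ O(n - 1)`
  (`leftParts_iso_of_natCast_ne_zero`).

Morphisms out of a sum of two line bundles are given by generators over the charts that are
compatible with the transition functions (`exists_hom_of_isGenerator`), and such a morphism is an
isomorphism if it carries the generators to a basis on small open sets (`isIso_biprod_desc`). Both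
facts enter through `isLocallyFree_and_nonempty_iso`, which treats the left and the right structure
at once.
-/

noncomputable section

namespace PrincipalParts

/-! ### Sheaves of modules and generators -/

section Sections

variable {X : Scheme.{u}}

/-- Restriction of sections of a sheaf of modules. -/
def res (M : X.Modules) {V U : X.Opens} (h : V ≤ U) : Γ(M, U) →+ Γ(M, V) :=
  (M.presheaf.map (homOfLE h).op).hom

/-- Restriction of regular functions. -/
def resO (X : Scheme.{u}) {V U : X.Opens} (h : V ≤ U) : Γ(X, U) →+* Γ(X, V) :=
  (X.presheaf.map (homOfLE h).op).hom

theorem res_smul (M : X.Modules) {V U : X.Opens} (h : V ≤ U) (r : Γ(X, U)) (x : Γ(M, U)) :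
    res M h (r • x) = resO X h r • res M h x :=
  M.map_smul (homOfLE h) r x

@[simp]
theorem res_res (M : X.Modules) {W V U : X.Opens} (h : V ≤ U) (h' : W ≤ V) (x : Γ(M, U)) :
    res M h' (res M h x) = res M (h'.trans h) x := by
  have := M.presheaf.map_comp (homOfLE h).op (homOfLE h').op
  exact (congr($this x)).symm

@[simp]
theorem res_self (M : X.Modules) {U : X.Opens} (x : Γ(M, U)) : res M le_rfl x = x := by
  have := M.presheaf.map_id (op U)
  exact congr($this x)

theorem app_res {M N : X.Modules} (φ : M ⟶ N) {V U : X.Opens} (h : V ≤ U) (x : Γ(M, U)) :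
    φ.app V (res M h x) = res N h (φ.app U x) := by
  have := φ.mapPresheaf.naturality (homOfLE h).op
  exact congr($this x)

theorem existsUnique_glue (M : X.Modules) {ι : Type*} (U : ι → X.Opens) {W : X.Opens}
    (hW : ∀ i, U i ≤ W) (hcover : W ≤ iSup U) (x : ∀ i, Γ(M, U i))
    (h : ∀ i j, res M (inf_le_left : U i ⊓ U j ≤ U i) (x i) =
      res M (inf_le_right : U i ⊓ U j ≤ U j) (x j)) :
    ∃! y : Γ(M, W), ∀ i, res M (hW i) y = x i :=
  TopCat.Sheaf.existsUnique_gluing' (⟨M.presheaf, M.isSheaf⟩ : TopCat.Sheaf Ab X) U W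
    (fun i => homOfLE (hW i)) hcover x h

/-- A morphism of sheaves of modules that is bijective on arbitrarily small neighbourhoods of every
point is an isomorphism. -/
theorem isIso_of_bijective {M N : X.Modules} (φ : M ⟶ N)
    (h : ∀ (x : X) (W : X.Opens), x ∈ W → ∃ V : X.Opens, x ∈ V ∧ V ≤ W ∧
      Function.Bijective (φ.app V)) : IsIso φ := by
  let F : TopCat.Sheaf Ab X := ⟨M.presheaf, M.isSheaf⟩
  let G : TopCat.Sheaf Ab X := ⟨N.presheaf, N.isSheaf⟩
  let ψ : F ⟶ G := ⟨φ.mapPresheaf⟩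
  let B : {V : X.Opens // Function.Bijective (φ.app V)} → Opens X := Subtype.val
  have hB : Opens.IsBasis (Set.range B) := by
    rw [Opens.isBasis_iff_nbhd]
    intro U x hx
    obtain ⟨V, hxV, hV, hb⟩ := h x U hx
    exact ⟨V, ⟨⟨V, hb⟩, rfl⟩, hxV, hV⟩
  have hψ : IsIso ψ := TopCat.Sheaf.isIso_iff_isIso_basis hB fun i =>
    (ConcreteCategory.isIso_iff_bijective (φ.app i.1)).2 i.2
  rw [Scheme.Modules.Hom.isIso_iff_isIso_app]
  intro U
  have : IsIso ψ.hom := inferInstanceAs (IsIso ((TopCat.Sheaf.forget Ab X).map ψ))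
  exact inferInstanceAs (IsIso (ψ.hom.app (op U)))

/-- The section `e` over `U` is a basis of `M` on `U`: multiplication by `e` identifies the sections
of the structure sheaf with those of `M` over all open subsets of `U`. -/
def IsGenerator (M : X.Modules) {U : X.Opens} (e : Γ(M, U)) : Prop :=
  ∀ (W : X.Opens) (h : W ≤ U), Function.Bijective fun a : Γ(X, W) => a • res M h e

/-- The morphism of sheaves of modules with prescribed components. -/
def homMk {M N : X.Modules} (φ : ∀ U : X.Opens, Γ(M, U) →+ Γ(N, U))
    (hsmul : ∀ (U : X.Opens) (r : Γ(X, U)) (x : Γ(M, U)), φ U (r • x) = r • φ U x)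
    (hres : ∀ (V U : X.Opens) (h : V ≤ U) (x : Γ(M, U)), φ V (res M h x) = res N h (φ U x)) :
    M ⟶ N :=
  SheafOfModules.Hom.mk (PresheafOfModules.homMk
    { app := fun U => AddCommGrpCat.ofHom (φ U.unop)
      naturality := fun U V i => by
        ext x
        exact hres V.unop U.unop i.unop.le x }
    (fun U r x => hsmul U.unop r x))

/-- Let `L` have generators `l i` over the open sets `U i`, and let the sections of `N` be determined
by gluing along the `U i`, which need not cover `X`. Then `L` maps to `N` as soon as there are
sections `s i` of `N` that satisfy the relations between the `l i`. -/
theorem exists_hom_of_isGenerator_of_glue {L N : X.Modules} {ι : Type*} (U : ι → X.Opens)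
    (hN : ∀ (W : X.Opens) (x : ∀ i, Γ(N, W ⊓ U i)),
      (∀ i j, res N (inf_le_left : W ⊓ U i ⊓ (W ⊓ U j) ≤ W ⊓ U i) (x i) =
        res N (inf_le_right : W ⊓ U i ⊓ (W ⊓ U j) ≤ W ⊓ U j) (x j)) →
      ∃! y : Γ(N, W), ∀ i, res N inf_le_left y = x i)
    (l : ∀ i, Γ(L, U i)) (hl : ∀ i, IsGenerator L (l i)) (s : ∀ i, Γ(N, U i))
    (hs : ∀ (i j : ι) (W : X.Opens) (hi : W ≤ U i) (hj : W ≤ U j) (a b : Γ(X, W)),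
      a • res L hi (l i) = b • res L hj (l j) → a • res N hi (s i) = b • res N hj (s j)) :
    ∃ φ : L ⟶ N, ∀ i, φ.app (U i) (l i) = s i := by
  -- the coefficient of a section with respect to the generator `l i`
  have hc : ∀ (W : X.Opens) (i : ι) (x : Γ(L, W)), ∃ a : Γ(X, W ⊓ U i),
      a • res L inf_le_right (l i) = res L inf_le_left x := fun W i x =>
    ((hl i) (W ⊓ U i) inf_le_right).2 _
  choose c hc using hc
  have huniq : ∀ (W : X.Opens) (i : ι) (h : W ≤ U i) (a b : Γ(X, W)),
      a • res L h (l i) = b • res L h (l i) → a = b := fun W i h a b hab => (hl i W h).1 hab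
  have hglue : ∀ (W : X.Opens) (x : Γ(L, W)), ∃! y : Γ(N, W), ∀ i,
      res N (inf_le_left : W ⊓ U i ≤ W) y = c W i x • res N inf_le_right (s i) := by
    intro W x
    refine hN W _ fun i j => ?_
    rw [res_smul, res_smul, res_res, res_res]
    refine hs i j _ _ _ _ _ ?_
    have h1 := congrArg (res L (inf_le_left : W ⊓ U i ⊓ (W ⊓ U j) ≤ W ⊓ U i)) (hc W i x)
    have h2 := congrArg (res L (inf_le_right : W ⊓ U i ⊓ (W ⊓ U j) ≤ W ⊓ U j)) (hc W j x)
    rw [res_smul, res_res, res_res] at h1 h2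
    exact h1.trans h2.symm
  choose f hf hf' using hglue
  have hadd : ∀ (W : X.Opens) (x y : Γ(L, W)), f W (x + y) = f W x + f W y := by
    intro W x y
    refine (hf' W (x + y) _ fun i => ?_).symm
    rw [map_add, hf, hf, ← add_smul]
    congr 1
    refine huniq _ i inf_le_right _ _ ?_
    rw [add_smul, hc, hc, hc, map_add]
  refine ⟨homMk (fun W => AddMonoidHom.mk' (f W) (hadd W)) (fun W r x => ?_)
    (fun V W h x => ?_), fun i => ?_⟩
  · refine (hf' W (r • x) _ fun i => ?_).symm
    change res N _ (r • f W x) = _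
    rw [res_smul, hf, smul_smul]
    congr 1
    refine huniq _ i inf_le_right _ _ ?_
    rw [mul_smul, hc, hc, res_smul]
  · refine (hf' V (res L h x) _ fun i => ?_).symm
    change res N _ (res N h (f W x)) = _
    rw [res_res]
    have := congrArg (res N (inf_le_inf_right (U i) h)) (hf W x i)
    rw [res_res, res_smul, res_res] at this
    rw [this]
    congr 1
    refine huniq _ i inf_le_right _ _ ?_
    have h2 := congrArg (res L (inf_le_inf_right (U i) h)) (hc W i x)
    rw [res_smul, res_res, res_res] at h2
    rw [hc, h2, res_res]
  · refine (hf' (U i) (l i) _ fun j => ?_).symm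
    have h := hc (U i) j (l i)
    have := hs j i _ inf_le_right inf_le_left (c (U i) j (l i)) 1 (by rw [h, one_smul])
    rw [this, one_smul]

/-- A line bundle given by generators `l i` over the members of an open cover maps to any sheaf of
modules with sections `s i` that satisfy the relations between the `l i`. -/
theorem exists_hom_of_isGenerator {L N : X.Modules} {ι : Type*} (U : ι → X.Opens)
    (hU : iSup U = ⊤) (l : ∀ i, Γ(L, U i)) (hl : ∀ i, IsGenerator L (l i)) (s : ∀ i, Γ(N, U i))
    (hs : ∀ (i j : ι) (W : X.Opens) (hi : W ≤ U i) (hj : W ≤ U j) (a b : Γ(X, W)),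
      a • res L hi (l i) = b • res L hj (l j) → a • res N hi (s i) = b • res N hj (s j)) :
    ∃ φ : L ⟶ N, ∀ i, φ.app (U i) (l i) = s i := by
  refine exists_hom_of_isGenerator_of_glue U (fun W x hx => ?_) l hl s hs
  refine existsUnique_glue N (fun i => W ⊓ U i) (fun i => inf_le_left) ?_ x hx
  rw [← inf_iSup_eq, hU, inf_top_eq]

/-- A line bundle with generator `e` over `U` corepresents the sections over `U` on the sheaves of
modules that are extended from `U`. -/
theorem bijective_app_of_isGenerator {L N : X.Modules} {U : X.Opens} {e : Γ(L, U)}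
    (he : IsGenerator L e)
    (hN : ∀ W : X.Opens, Function.Bijective (res N (inf_le_left : W ⊓ U ≤ W))) :
    Function.Bijective fun φ : L ⟶ N => φ.app U e := by
  constructor
  · intro φ ψ h
    ext W x
    refine (hN W).1 ?_
    obtain ⟨a, ha⟩ := (he (W ⊓ U) inf_le_right).2 (res L inf_le_left x)
    have h' : φ.app U e = ψ.app U e := h
    rw [← app_res, ← app_res, ← ha]
    simp only [Scheme.Modules.Hom.app_smul, app_res, h']
  · intro s
    refine (exists_hom_of_isGenerator_of_glue (N := N) (fun _ : Unit => U)
      (fun W x _ => ?_) (fun _ => e) (fun _ => he) (fun _ => s)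
      (fun _ _ W h _ a b hab => ?_)).imp fun φ hφ => hφ ()
    · obtain ⟨y, hy⟩ := (hN W).2 (x ())
      exact ⟨y, fun _ => hy, fun z hz => (hN W).1 ((hz ()).trans hy.symm)⟩
    · rw [(he W h).1 hab]

end Sections

/-! ### Sums of two line bundles -/

section Biproduct

variable {X : Scheme.{u}} {L M N : X.Modules}

theorem biprod_decomp (W : X.Opens) (z : Γ(L ⊞ M, W)) :
    (biprod.inl : L ⟶ L ⊞ M).app W ((biprod.fst : L ⊞ M ⟶ L).app W z) +
      (biprod.inr : M ⟶ L ⊞ M).app W ((biprod.snd : L ⊞ M ⟶ M).app W z) = z := by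
  have := congrArg (fun f : L ⊞ M ⟶ L ⊞ M => f.app W z) (biprod.total (X := L) (Y := M))
  exact this

/-- A pair of morphisms from line bundles into `N` that gives a basis of `N` locally identifies `N`
with the direct sum. -/
theorem isIso_biprod_desc (φ : L ⟶ N) (ψ : M ⟶ N)
    (h : ∀ (x : X) (W : X.Opens), x ∈ W → ∃ (V : X.Opens) (l : Γ(L, V)) (m : Γ(M, V)),
      x ∈ V ∧ V ≤ W ∧ IsGenerator L l ∧ IsGenerator M m ∧
      Function.Bijective fun a : Γ(X, V) × Γ(X, V) => a.1 • φ.app V l + a.2 • ψ.app V m) :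
    IsIso (biprod.desc φ ψ) := by
  refine isIso_of_bijective _ fun x W hx => ?_
  obtain ⟨V, l, m, hxV, hV, hl, hm, hb⟩ := h x W hx
  refine ⟨V, hxV, hV, ?_⟩
  have hl' : ∀ y : Γ(L, V), ∃ a : Γ(X, V), a • l = y := fun y => by
    simpa using (hl V le_rfl).2 y
  have hm' : ∀ y : Γ(M, V), ∃ a : Γ(X, V), a • m = y := fun y => by
    simpa using (hm V le_rfl).2 y
  have hinl : ∀ y : Γ(L, V), (biprod.desc φ ψ).app V ((biprod.inl : L ⟶ L ⊞ M).app V y) =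
      φ.app V y := fun y => congrArg (fun f : L ⟶ N => f.app V y) (biprod.inl_desc φ ψ)
  have hinr : ∀ y : Γ(M, V), (biprod.desc φ ψ).app V ((biprod.inr : M ⟶ L ⊞ M).app V y) =
      ψ.app V y := fun y => congrArg (fun f : M ⟶ N => f.app V y) (biprod.inr_desc φ ψ)
  constructor
  · rw [injective_iff_map_eq_zero]
    intro z hz
    rw [← biprod_decomp V z] at hz ⊢
    obtain ⟨a, ha⟩ := hl' ((biprod.fst : L ⊞ M ⟶ L).app V z)
    obtain ⟨b, hb'⟩ := hm' ((biprod.snd : L ⊞ M ⟶ M).app V z)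
    rw [map_add, hinl, hinr, ← ha, ← hb', Scheme.Modules.Hom.app_smul,
      Scheme.Modules.Hom.app_smul] at hz
    have h0 := @hb.1 (a, b) (0, 0) (by simpa using hz)
    obtain ⟨rfl, rfl⟩ := Prod.ext_iff.1 h0
    rw [← ha, ← hb']
    simp
  · intro y
    obtain ⟨⟨a, b⟩, rfl⟩ := hb.2 y
    refine ⟨(biprod.inl : L ⟶ L ⊞ M).app V (a • l) + (biprod.inr : M ⟶ L ⊞ M).app V (b • m), ?_⟩
    rw [map_add, hinl, hinr, Scheme.Modules.Hom.app_smul, Scheme.Modules.Hom.app_smul]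

end Biproduct

/-! ### Restriction, pullback and local freeness -/

section Restriction

variable {X : Scheme.{u}}

/-- The structure sheaf as a module over itself. -/
def structureModule (X : Scheme.{u}) : X.Modules := SheafOfModules.unit X.ringCatSheaf

/-- The section `1` of the structure sheaf. -/
def structureOne (U : X.Opens) : Γ(structureModule X, U) := (1 : Γ(X, U))

theorem smul_res_structureOne {U W : X.Opens} (h : W ≤ U) (a : Γ(X, W)) :
    (a • res (structureModule X) h (structureOne U) : Γ(structureModule X, W)) = a := by
  have h1 : res (structureModule X) h (structureOne U) = (1 : Γ(X, W)) := map_one (resO X h)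
  rw [h1]
  exact mul_one a

theorem isGenerator_structureOne (U : X.Opens) :
    IsGenerator (structureModule X) (structureOne U) := fun W h => by
  have : (fun a : Γ(X, W) => (a • res (structureModule X) h (structureOne U) :
      Γ(structureModule X, W))) = fun a : Γ(X, W) => (a : Γ(structureModule X, W)) :=
    funext fun a => smul_res_structureOne h a
  rw [this]
  exact Function.bijective_id

/-- A section over `U` is a generator on `U` if and only if it is one of the restriction to `U`. -/
theorem isGenerator_restrict_iff (M : X.Modules) {U : X.Opens} (e : Γ(M, U)) :
    IsGenerator (M.restrict U.ι) (U := U.ι ⁻¹ᵁ U)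
      (res M (U.ι.image_preimage_le U) e : Γ(M, U.ι ''ᵁ U.ι ⁻¹ᵁ U)) ↔ IsGenerator M e := by
  have key : ∀ (W : U.toScheme.Opens) (h : W ≤ U.ι ⁻¹ᵁ U) (h' : U.ι ''ᵁ W ≤ U)
      (a : Γ(X, U.ι ''ᵁ W)),
      ((show Γ(U, W) from a) • res (M.restrict U.ι) h
        (res M (U.ι.image_preimage_le U) e : Γ(M, U.ι ''ᵁ U.ι ⁻¹ᵁ U)) :
        Γ(M.restrict U.ι, W)) = (a • res M h' e : Γ(M, U.ι ''ᵁ W)) := by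
    intro W h h' a
    rw [← res_res M (U.ι.image_preimage_le U) (U.ι.image_mono h)]
    have h1 := Scheme.Modules.smul_restrictAppIso_hom_apply U.ι M W a
    rw [Scheme.Opens.ι_appIso] at h1
    exact h1 _
  constructor
  · intro H W h
    obtain ⟨W, rfl⟩ : ∃ W' : U.toScheme.Opens, W = U.ι ''ᵁ W' :=
      ⟨U.ι ⁻¹ᵁ W, by
        rw [Scheme.Hom.image_preimage_eq_opensRange_inf, Scheme.Opens.opensRange_ι,
          inf_eq_right.2 h]⟩
    have h' : W ≤ U.ι ⁻¹ᵁ U := fun x _ => x.2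
    exact (funext (key W h' h)) ▸ H W h'
  · intro H W h
    have h' : U.ι ''ᵁ W ≤ U := (U.ι.image_mono h).trans (U.ι.image_preimage_le U)
    exact (funext (key W h h')).symm ▸ H _ h'

theorem bijective_res_of_le (M : X.Modules) {V U : X.Opens} (h : V ≤ U) (h' : U ≤ V) :
    Function.Bijective (res M h) := by
  obtain rfl := le_antisymm h h'
  convert Function.bijective_id using 2
  exact funext fun x => res_self M x

/-- A sheaf of modules with a global generator is isomorphic to the structure sheaf. -/
theorem nonempty_iso_of_isGenerator {M : X.Modules} {U : X.Opens} (hU : ⊤ ≤ U) {e : Γ(M, U)}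
    (he : IsGenerator M e) : Nonempty (structureModule X ≅ M) := by
  have hK : ∀ (K : X.Modules) (W : X.Opens),
      Function.Bijective (res K (inf_le_left : W ⊓ U ≤ W)) := fun K W =>
    bijective_res_of_le K _ (le_inf le_rfl (le_top.trans hU))
  obtain ⟨φ, hφ⟩ := (bijective_app_of_isGenerator (isGenerator_structureOne U) (hK M)).2 e
  obtain ⟨ψ, hψ⟩ := (bijective_app_of_isGenerator he (hK (structureModule X))).2 (structureOne U)
  refine ⟨⟨φ, ψ, ?_, ?_⟩⟩
  · refine (bijective_app_of_isGenerator (isGenerator_structureOne U) (hK _)).1 ?_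
    exact (congrArg (fun x => ψ.app U x) hφ).trans hψ
  · refine (bijective_app_of_isGenerator he (hK _)).1 ?_
    exact (congrArg (fun x => φ.app U x) hψ).trans hφ

end Restriction

section Pullback

variable {X Y : Scheme.{u}} (f : Y ⟶ X) (L : X.Modules)

/-- The pullback of a section. -/
def pullbackSection {U : X.Opens} (e : Γ(L, U)) :
    Γ((Scheme.Modules.pullback f).obj L, f ⁻¹ᵁ U) :=
  ((Scheme.Modules.pullbackPushforwardAdjunction f).unit.app L).app U e

theorem pullbackSection_smul {U : X.Opens} (a : Γ(X, U)) (e : Γ(L, U)) :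
    pullbackSection f L (a • e) = f.app U a • pullbackSection f L e :=
  Scheme.Modules.Hom.app_smul _ a e

theorem pullbackSection_res {V U : X.Opens} (h : V ≤ U) (e : Γ(L, U)) :
    pullbackSection f L (res L h e) =
      res ((Scheme.Modules.pullback f).obj L) (f.preimage_mono h) (pullbackSection f L e) :=
  app_res ((Scheme.Modules.pullbackPushforwardAdjunction f).unit.app L) h e

/-- The pullback of a generator is a generator: on the preimage of `U` the pullback corepresents the
same functor as the structure sheaf, by adjunction. -/
theorem isGenerator_pullbackSection {U : X.Opens} {e : Γ(L, U)} (he : IsGenerator L e) :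
    IsGenerator ((Scheme.Modules.pullback f).obj L) (pullbackSection f L e) := by
  let V := f ⁻¹ᵁ U
  let G := (Scheme.Modules.pullback f).obj L
  let T := V.ι ⁻¹ᵁ V
  let g : Γ(G.restrict V.ι, T) :=
    (res G (V.ι.image_preimage_le V) (pullbackSection f L e) : Γ(G, V.ι ''ᵁ V.ι ⁻¹ᵁ V))
  have hT : ⊤ ≤ T := fun x _ => x.2
  have hK : ∀ (N : V.toScheme.Modules) (W : V.toScheme.Opens),
      Function.Bijective (res N (inf_le_left : W ⊓ T ≤ W)) := fun N W =>
    bijective_res_of_le N _ (le_inf le_rfl (le_top.trans hT))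
  -- both `g` and `1` corepresent the functor of global sections on sheaves of modules on `V`
  have hg : ∀ N : V.toScheme.Modules,
      Function.Bijective fun φ : G.restrict V.ι ⟶ N => φ.app T g := by
    intro N
    have h3 := bijective_app_of_isGenerator (L := L) he
      (N := (Scheme.Modules.pushforward f).obj ((Scheme.Modules.pushforward V.ι).obj N))
      fun W => bijective_res_of_le N
        (V.ι.preimage_mono (f.preimage_mono inf_le_left)) fun x hx => ⟨hx, x.2⟩
    have h4 := h3.comp (((Scheme.Modules.restrictAdjunction V.ι).homEquiv G N).trans
      ((Scheme.Modules.pullbackPushforwardAdjunction f).homEquiv L _)).bijective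
    exact h4
  have h1 := fun N : V.toScheme.Modules =>
    bijective_app_of_isGenerator (isGenerator_structureOne T) (hK N)
  obtain ⟨ψ, hψ⟩ := (h1 (G.restrict V.ι)).2 g
  have hψ' : IsIso ψ := by
    refine isIso_of_coyoneda_map_bijective ψ fun N => ?_
    refine (Function.Bijective.of_comp_iff' (h1 N) _).1 ?_
    convert hg N using 1
    funext φ
    exact congrArg (fun x => φ.app T x) hψ
  rw [← isGenerator_restrict_iff]
  intro W hW
  have hb := ((ConcreteCategory.isIso_iff_bijective (ψ.app W)).1 inferInstance).comp
    (isGenerator_structureOne T W hW)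
  convert hb using 1
  funext a
  refine (Eq.trans ?_ (Scheme.Modules.Hom.app_smul ψ a _).symm)
  exact congrArg (fun x => a • x)
    ((congrArg (res (G.restrict V.ι) hW) hψ).symm.trans (app_res ψ hW _).symm)

end Pullback

section LocallyFree

/-- A sum of two line bundles is locally free. The generators have to be moved to the sheaf of
modules over each `U i`, in terms of which local freeness is stated. -/
theorem isLocallyFree_of_iso_biprod {X : Scheme.{u}} {N L M : X.Modules} (i : N ≅ L ⊞ M)
    {ι : Type u} (U : ι → X.Opens) (hU : iSup U = ⊤)
    (l : ∀ i, Γ(L, U i)) (hl : ∀ i, IsGenerator L (l i))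
    (m : ∀ i, Γ(M, U i)) (hm : ∀ i, IsGenerator M (m i)) : IsLocallyFree N := by
  have key : ∀ j, ∃ σ : SheafOfModules.GeneratingSections.{u}
      (SheafOfModules.over (R := X.ringCatSheaf) N (U j)), IsIso σ.π := by
    intro j
    obtain ⟨e1⟩ := nonempty_iso_of_isGenerator (U := (U j).ι ⁻¹ᵁ U j) (fun x _ => x.2)
      ((isGenerator_restrict_iff L (l j)).2 (hl j))
    obtain ⟨e2⟩ := nonempty_iso_of_isGenerator (U := (U j).ι ⁻¹ᵁ U j) (fun x _ => x.2)
      ((isGenerator_restrict_iff M (m j)).2 (hm j))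
    let R := X.ringCatSheaf
    let O : SheafOfModules.{u} (U j).toScheme.ringCatSheaf := SheafOfModules.unit _
    let E : SheafOfModules.{u} (R.over (U j)) ≌ SheafOfModules.{u} (U j).toScheme.ringCatSheaf :=
      Scheme.Modules.overEquiv (U j)
    -- the free sheaf of rank two
    obtain ⟨σ, hσ⟩ : ∃ σ : SheafOfModules.GeneratingSections.{u} (O ⊞ O), IsIso σ.π := by
      let I : Type u := PUnit
      let s : SheafOfModules.free (R := (U j).toScheme.ringCatSheaf) I ≅ O :=
        coproductUniqueIso _
      let c : SheafOfModules.free (R := (U j).toScheme.ringCatSheaf) (I ⊕ I) ≅ O ⊞ O :=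
        (SheafOfModules.freeSumIso I I).symm ≪≫ coprod.mapIso s s ≪≫ (biprod.isoCoprod O O).symm
      refine ⟨(SheafOfModules.free.generatingSections (I ⊕ I)).ofEpi c.hom, ?_⟩
      rw [SheafOfModules.GeneratingSections.ofEpi_π,
        SheafOfModules.free.generatingSections_π]
      exact @IsIso.comp_isIso _ _ _ _ _ _ _ (IsIso.id _) (Iso.isIso_hom c)
    let η : SheafOfModules.unit (R.over (U j)) ≅ E.inverse.obj O :=
      (TopologicalSpace.Opens.sheafOfModulesEquivOverInverseUnit (U j) R).symm
    let r := Scheme.Modules.restrictFunctor (U j).ι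
    have : PreservesBinaryBiproducts r :=
      preservesBinaryBiproducts_of_preservesBinaryCoproducts r
    let a' : (structureModule (U j).toScheme ⊞ structureModule (U j).toScheme) ≅ r.obj N :=
      biprod.mapIso e1 e2 ≪≫ (r.mapBiprod L M).symm ≪≫ r.mapIso i.symm
    let a : (O ⊞ O) ≅ E.functor.obj (SheafOfModules.over (R := R) N (U j)) :=
      a' ≪≫ ((Scheme.Modules.overFunctorEquiv (U j)).app N).symm
    let τ := σ.map E.inverse η
    have hτ : IsIso τ.π := inferInstance
    let b : E.inverse.obj (O ⊞ O) ≅ SheafOfModules.over (R := R) N (U j) :=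
      E.inverse.mapIso a ≪≫ (E.unitIso.app _).symm
    refine ⟨τ.ofEpi b.hom, ?_⟩
    rw [SheafOfModules.GeneratingSections.ofEpi_π]
    have hb : IsIso b.hom := inferInstance
    exact @IsIso.comp_isIso _ _ _ _ _ _ _ hτ hb
  choose σ hσ using key
  let q : SheafOfModules.LocalGeneratorsData.{u} (R := X.ringCatSheaf) N :=
    { I := ι
      X := U
      coversTop := by
        rw [Opens.coversTop_iff]
        exact hU
      generators := σ }
  have hq : ∃ q : SheafOfModules.LocalGeneratorsData.{u} (R := X.ringCatSheaf) N,
      q.IsLocallyFreeData := ⟨q, by constructor; exact hσ⟩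
  exact { exists_isLocallyFreeData := hq }

end LocallyFree

/-! ### Principal parts of a polynomial ring -/

section Algebra

open TensorProduct

variable {R A : Type*} [CommRing R] [CommRing A] [Algebra R A]

/-- If `A` is a polynomial ring in `t` over `R`, the Taylor expansion `f ↦ f + f' ε` defines an
algebra homomorphism `A ⊗ A → A[ε]` on the second factor. It lies over the multiplication map. -/
theorem exists_taylor_hom {t : A} (ht : Function.Bijective (Polynomial.aeval (R := R) t)) :
    ∃ δ : A ⊗[R] A →ₐ[R] DualNumber A, (∀ a, δ (a ⊗ₜ 1) = TrivSqZeroExt.inl a) ∧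
      δ (1 ⊗ₜ t) = TrivSqZeroExt.inl t + DualNumber.eps ∧
      ∀ x, (δ x).fst = Algebra.TensorProduct.lmul' R x := by
  let e := AlgEquiv.ofBijective (Polynomial.aeval (R := R) t) ht
  have he : ∀ P, e.symm (Polynomial.aeval t P) = P := e.symm_apply_apply
  obtain ⟨δ₁, h1⟩ : ∃ δ₁ : A →ₐ[R] DualNumber A, ∀ a, δ₁ a = TrivSqZeroExt.inl a :=
    ⟨TrivSqZeroExt.inlAlgHom R A A, fun _ => rfl⟩
  obtain ⟨δ₂, h2⟩ : ∃ δ₂ : A →ₐ[R] DualNumber A, ∀ P : Polynomial R, δ₂ (Polynomial.aeval t P) =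
      Polynomial.aeval (TrivSqZeroExt.inl t + DualNumber.eps : DualNumber A) P :=
    ⟨(Polynomial.aeval (TrivSqZeroExt.inl t + DualNumber.eps)).comp e.symm.toAlgHom,
      fun P => congrArg _ (he P)⟩
  have h3 : ∀ a, (δ₂ a).fst = a := by
    intro a
    obtain ⟨P, rfl⟩ := ht.2 a
    have : (TrivSqZeroExt.fstHom R A A).comp
        (Polynomial.aeval (TrivSqZeroExt.inl t + DualNumber.eps)) = Polynomial.aeval t := by
      ext
      simp
    rw [h2]
    exact congr($this P)
  refine ⟨Algebra.TensorProduct.lift δ₁ δ₂ fun _ _ => Commute.all _ _, fun a => ?_, ?_, fun x => ?_⟩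
  · rw [Algebra.TensorProduct.lift_tmul, map_one, mul_one, h1]
  · have := h2 Polynomial.X
    rw [Polynomial.aeval_X, Polynomial.aeval_X] at this
    rw [Algebra.TensorProduct.lift_tmul, map_one, one_mul, this]
  · induction x with
    | zero => simp
    | add x y hx hy => rw [map_add, map_add, TrivSqZeroExt.fst_add, hx, hy]
    | tmul a b =>
      rw [Algebra.TensorProduct.lift_tmul, TrivSqZeroExt.fst_mul, h1, h3,
        TrivSqZeroExt.fst_inl, Algebra.TensorProduct.lmul'_apply_tmul]

/-- The algebra of first-order principal parts of a polynomial ring `A = R[t]`: the quotient of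
`A ⊗ A` by the square of the diagonal ideal has the basis `1`, `dt` as a module over the first
factor. -/
theorem bijective_principalParts {B : Type*} [CommRing B] {t : A}
    (ht : Function.Bijective (Polynomial.aeval (R := R) t)) (π : A ⊗[R] A →+* B)
    (hπ : Function.Surjective π) (K : Ideal (A ⊗[R] A))
    (hK : K ≤ RingHom.ker (Algebra.TensorProduct.lmul' R (S := A)))
    (hdK : 1 ⊗ₜ t - t ⊗ₜ 1 ∈ K)
    (hker : RingHom.ker π = K ^ 2) :
    Function.Bijective fun a : A × A =>
      π (a.1 ⊗ₜ 1) + π (a.2 ⊗ₜ 1) * (π (1 ⊗ₜ t) - π (t ⊗ₜ 1)) := by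
  have hsq : (π (1 ⊗ₜ t) - π (t ⊗ₜ 1)) ^ 2 = 0 := by
    rw [← map_sub, ← map_pow, ← RingHom.mem_ker, hker]
    exact Ideal.pow_mem_pow hdK 2
  set ξ := π (1 ⊗ₜ t) - π (t ⊗ₜ 1) with hξ
  have htξ : π (1 ⊗ₜ t) = π (t ⊗ₜ 1) + ξ := by rw [hξ]; ring
  have hmul : ∀ a b : A, π ((a * b) ⊗ₜ 1) = π (a ⊗ₜ 1) * π (b ⊗ₜ 1) := fun a b => by
    rw [← map_mul, Algebra.TensorProduct.tmul_mul_tmul, one_mul]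
  have hadd : ∀ a b : A, π ((a + b) ⊗ₜ 1) = π (a ⊗ₜ 1) + π (b ⊗ₜ 1) := fun a b => by
    rw [← map_add, TensorProduct.add_tmul]
  constructor
  · obtain ⟨δ, hδ1, hδt, hδm⟩ := exists_taylor_hom ht
    have hzero : ∀ x : A ⊗[R] A, π x = 0 → δ x = 0 := by
      intro x hx
      rw [← RingHom.mem_ker, hker] at hx
      have h1 : K ^ 2 ≤ RingHom.ker δ := by
        rw [pow_two, Ideal.mul_le]
        intro y hy z hz
        have hy' : (δ y).fst = 0 := (hδm y).trans (hK hy)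
        have hz' : (δ z).fst = 0 := (hδm z).trans (hK hz)
        rw [RingHom.mem_ker, map_mul]
        ext <;> simp [hy', hz']
      exact h1 hx
    rintro ⟨a, c⟩ ⟨a', c'⟩ h
    have h0 : π ((a - a') ⊗ₜ 1 + ((c - c') ⊗ₜ 1) * (1 ⊗ₜ t - t ⊗ₜ 1)) = 0 := by
      simp only at h
      rw [map_add, map_mul, map_sub, ← hξ, TensorProduct.sub_tmul, TensorProduct.sub_tmul, map_sub,
        map_sub]
      linear_combination h
    have h1 := hzero _ h0
    rw [map_add, map_mul, map_sub, hδ1, hδ1, hδ1, hδt] at h1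
    have h2 := congrArg TrivSqZeroExt.fst h1
    have h3 := congrArg TrivSqZeroExt.snd h1
    simp at h2 h3
    exact Prod.ext (sub_eq_zero.1 h2) (sub_eq_zero.1 h3)
  · -- the right factor lies in the span of `1` and `dt` over the left factor
    have hr : ∀ P : Polynomial R, ∃ a : A × A,
        π (a.1 ⊗ₜ 1) + π (a.2 ⊗ₜ 1) * ξ = π (1 ⊗ₜ Polynomial.aeval t P) := by
      intro P
      induction P using Polynomial.induction_on with
      | C c =>
        refine ⟨(algebraMap R A c, 0), ?_⟩
        rw [Polynomial.aeval_C, TensorProduct.zero_tmul, map_zero, zero_mul, add_zero,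
          Algebra.algebraMap_eq_smul_one, TensorProduct.smul_tmul]
      | add P Q hP hQ =>
        obtain ⟨a, ha⟩ := hP
        obtain ⟨b, hb⟩ := hQ
        refine ⟨a + b, ?_⟩
        rw [map_add, TensorProduct.tmul_add, map_add, ← ha, ← hb, Prod.fst_add, Prod.snd_add,
          hadd, hadd]
        ring
      | monomial n c hn =>
        obtain ⟨a, ha⟩ := hn
        refine ⟨(a.1 * t, a.1 + a.2 * t), ?_⟩
        have : (1 : A) ⊗ₜ[R] Polynomial.aeval t (Polynomial.C c * Polynomial.X ^ (n + 1)) =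
            (1 ⊗ₜ Polynomial.aeval t (Polynomial.C c * Polynomial.X ^ n)) * (1 ⊗ₜ t) := by
          rw [Algebra.TensorProduct.tmul_mul_tmul, one_mul, pow_succ, ← mul_assoc, map_mul _ _
            Polynomial.X, Polynomial.aeval_X]
        rw [this, map_mul, ← ha, htξ, hadd, hmul, hmul]
        linear_combination -π (a.2 ⊗ₜ 1) * hsq
    intro b
    obtain ⟨x, rfl⟩ := hπ b
    induction x with
    | zero => exact ⟨0, by simp⟩
    | add x y hx hy =>
      obtain ⟨a, ha⟩ := hx
      obtain ⟨b, hb⟩ := hy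
      refine ⟨a + b, ?_⟩
      simp only at ha hb ⊢
      rw [map_add, ← ha, ← hb, Prod.fst_add, Prod.snd_add, hadd, hadd]
      ring
    | tmul a b =>
      obtain ⟨P, rfl⟩ := ht.2 b
      obtain ⟨c, hc⟩ := hr P
      refine ⟨(a * c.1, a * c.2), ?_⟩
      have : a ⊗ₜ[R] Polynomial.aeval t P = (a ⊗ₜ 1) * (1 ⊗ₜ Polynomial.aeval t P) := by
        rw [Algebra.TensorProduct.tmul_mul_tmul, one_mul, mul_one]
      simp only
      rw [this, map_mul, ← hc, hmul, hmul]
      ring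

/-- If `1`, `ξ` is a basis of `B` over `A` through `l` and `r` agrees with `l` modulo `ξ`,
then `1`, `ξ` is also a basis through `r`. -/
theorem bijective_right_of_left {A B : Type*} [CommRing A] [CommRing B] (l r : A →+* B) (ξ : B)
    (hξ : ∀ a, (r a - l a) * ξ = 0) (hξξ : ξ * ξ = 0)
    (h : Function.Bijective fun a : A × A => l a.1 + l a.2 * ξ) :
    Function.Bijective fun a : A × A => r a.1 + r a.2 * ξ := by
  have h0 : ∀ a c, l a + l c * ξ = 0 → a = 0 ∧ c = 0 := fun a c hac =>
    Prod.ext_iff.1 (@h.1 (a, c) (0, 0) (by simpa using hac))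
  have hrl : ∀ a, r a * ξ = l a * ξ := fun a => by linear_combination hξ a
  constructor
  · rintro ⟨a, c⟩ ⟨a', c'⟩ hac
    simp only at hac
    have h1 : l 0 + l (a - a') * ξ = 0 := by
      rw [map_zero, zero_add, ← hrl, map_sub]
      linear_combination ξ * hac + (r c' - r c) * hξξ
    obtain ⟨-, h1⟩ := h0 _ _ h1
    obtain rfl := sub_eq_zero.1 h1
    have h2 : l 0 + l (c - c') * ξ = 0 := by
      rw [map_zero, zero_add, ← hrl, map_sub]
      linear_combination hac
    obtain ⟨-, h2⟩ := h0 _ _ h2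
    obtain rfl := sub_eq_zero.1 h2
    rfl
  · intro b
    obtain ⟨⟨a, c⟩, rfl⟩ := h.2 b
    obtain ⟨⟨a₁, c₁⟩, h1⟩ := h.2 (r a - l a)
    simp only at h1 ⊢
    have h2 : l 0 + l a₁ * ξ = 0 := by
      rw [map_zero, zero_add]
      linear_combination ξ * h1 - l c₁ * hξξ + hξ a
    obtain ⟨-, rfl⟩ := h0 _ _ h2
    refine ⟨(a, c - c₁), ?_⟩
    simp only
    rw [map_sub, sub_mul, hrl, hrl]
    rw [map_zero] at h1
    linear_combination -h1

/-- A basis `1`, `ξ` remains a basis after localization. -/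
theorem bijective_localization {A B A' B' : Type*} [CommRing A] [CommRing B] [CommRing A']
    [CommRing B'] [Algebra A A'] [Algebra B B'] (f : A) [IsLocalization.Away f A'] (l : A →+* B)
    [IsLocalization.Away (l f) B'] (l' : A' →+* B')
    (hl : ∀ a, l' (algebraMap A A' a) = algebraMap B B' (l a)) (ξ : B)
    (h : Function.Bijective fun a : A × A => l a.1 + l a.2 * ξ) :
    Function.Bijective fun a : A' × A' => l' a.1 + l' a.2 * algebraMap B B' ξ := by
  have hu : IsUnit (algebraMap A A' f) := IsLocalization.Away.algebraMap_isUnit f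
  have hu' : IsUnit (algebraMap B B' (l f)) := IsLocalization.Away.algebraMap_isUnit (l f)
  constructor
  · have key : ∀ a c : A', l' a + l' c * algebraMap B B' ξ = 0 → a = 0 ∧ c = 0 := by
      intro a c hac
      obtain ⟨n, a₁, ha⟩ := IsLocalization.Away.surj f a
      obtain ⟨m, c₁, hc⟩ := IsLocalization.Away.surj f c
      have h1 : algebraMap B B' (l (a₁ * f ^ m) + l (c₁ * f ^ n) * ξ) = 0 := by
        rw [map_add, map_mul _ _ ξ, ← hl, ← hl, map_mul _ a₁, map_mul _ c₁, ← ha, ← hc]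
        simp only [map_mul, map_pow]
        linear_combination l' (algebraMap A A' f) ^ n * l' (algebraMap A A' f) ^ m * hac
      rw [IsLocalization.map_eq_zero_iff (Submonoid.powers (l f))] at h1
      obtain ⟨⟨_, k, rfl⟩, hk⟩ := h1
      have h2 := @h.1 (f ^ k * (a₁ * f ^ m), f ^ k * (c₁ * f ^ n)) (0, 0) (by
        simp only [map_mul l, map_pow l, map_zero] at hk ⊢
        linear_combination hk)
      obtain ⟨h3, h4⟩ := Prod.ext_iff.1 h2
      have h3' := congrArg (algebraMap A A') h3
      have h4' := congrArg (algebraMap A A') h4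
      simp only [map_mul, map_pow, map_zero, ← ha, ← hc] at h3' h4'
      constructor
      · simpa [(hu.pow _).mul_right_eq_zero, (hu.pow _).mul_left_eq_zero] using h3'
      · simpa [(hu.pow _).mul_right_eq_zero, (hu.pow _).mul_left_eq_zero] using h4'
    rintro ⟨a, c⟩ ⟨a', c'⟩ hac
    simp only at hac
    obtain ⟨h1, h2⟩ := key (a - a') (c - c') (by
      rw [map_sub, map_sub]
      linear_combination hac)
    exact Prod.ext (sub_eq_zero.1 h1) (sub_eq_zero.1 h2)
  · intro b
    obtain ⟨n, b₁, hb⟩ := IsLocalization.Away.surj (l f) b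
    obtain ⟨⟨a, c⟩, rfl⟩ := h.2 b₁
    obtain ⟨v, hv⟩ := (hu.pow n).exists_right_inv
    refine ⟨(v * algebraMap A A' a, v * algebraMap A A' c), ?_⟩
    have hv' := congrArg l' hv
    simp only [map_mul, map_pow, map_one, hl, map_add] at hv' hb ⊢
    linear_combination b * hv' - l' v * hb

end Algebra

/-! ### Values of functions at ring-valued points -/

section Evaluation

variable {X Y : Scheme.{u}}

/-- The value of a function on `U` at a `T`-valued point with image in `U`. -/
def evalPoint {T : CommRingCat.{u}} (g : Spec T ⟶ X) {U : X.Opens} (h : ⊤ ≤ g ⁻¹ᵁ U) :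
    Γ(X, U) →+* T :=
  (g.appLE U ⊤ h ≫ (Scheme.ΓSpecIso T).hom).hom

theorem evalPoint_appLE {T : CommRingCat.{u}} (g : Spec T ⟶ Y) (m : Y ⟶ X) {U : X.Opens}
    {W : Y.Opens} (e : W ≤ m ⁻¹ᵁ U) (h : ⊤ ≤ g ⁻¹ᵁ W) (h' : ⊤ ≤ (g ≫ m) ⁻¹ᵁ U) (a : Γ(X, U)) :
    evalPoint g h ((m.appLE U W e).hom a) = evalPoint (g ≫ m) h' a := by
  have := Scheme.Hom.appLE_comp_appLE g m U W ⊤ e h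
  simp only [evalPoint]
  rw [← this]
  simp

theorem evalPoint_specMap {S T : CommRingCat.{u}} (ψ : S ⟶ T) (g : Spec S ⟶ X) {U : X.Opens}
    (h : ⊤ ≤ g ⁻¹ᵁ U) (h' : ⊤ ≤ (Spec.map ψ ≫ g) ⁻¹ᵁ U) (a : Γ(X, U)) :
    evalPoint (Spec.map ψ ≫ g) h' a = ψ (evalPoint g h a) := by
  have h1 := Scheme.Hom.appLE_comp_appLE (Spec.map ψ) g U ⊤ ⊤ h le_top
  have h2 := Scheme.ΓSpecIso_naturality ψ
  simp only [evalPoint]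
  rw [← h1]
  have h3 : (Spec.map ψ).appLE ⊤ ⊤ le_top = (Spec.map ψ).appTop := Scheme.Hom.appLE_eq_app _
  rw [h3, Category.assoc, h2]
  simp

theorem evalPoint_congr {T : CommRingCat.{u}} {g g' : Spec T ⟶ X} (e : g = g') {U : X.Opens}
    (h : ⊤ ≤ g ⁻¹ᵁ U) (h' : ⊤ ≤ g' ⁻¹ᵁ U) (a : Γ(X, U)) : evalPoint g h a = evalPoint g' h' a := by
  subst e
  rfl

theorem evalPoint_fromSpec {U : X.Opens} (hU : IsAffineOpen U) (h : ⊤ ≤ hU.fromSpec ⁻¹ᵁ U)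
    (a : Γ(X, U)) : evalPoint hU.fromSpec h a = a := by
  have : hU.fromSpec.appLE U ⊤ h ≫ (Scheme.ΓSpecIso _).hom = 𝟙 _ := by
    have hid : ∀ i : op (⊤ : (Spec Γ(X, U)).Opens) ⟶ op ⊤, (Spec Γ(X, U)).presheaf.map i = 𝟙 _ :=
      fun i => by
        rw [Subsingleton.elim i (𝟙 _), CategoryTheory.Functor.map_id]
    rw [Scheme.Hom.appLE, hU.fromSpec_app_self, Category.assoc, Category.assoc,
      ← Functor.map_comp_assoc, hid, Category.id_comp, Iso.inv_hom_id]
  simp only [evalPoint]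
  rw [this]
  rfl

theorem bijective_evalPoint {T : CommRingCat.{u}} (g : Spec T ⟶ X) [IsOpenImmersion g]
    {U : X.Opens} (h : ⊤ ≤ g ⁻¹ᵁ U) (hU : U ≤ g.opensRange) :
    Function.Bijective (evalPoint g h) := by
  have h1 : g ''ᵁ ⊤ ≤ U := by
    rintro _ ⟨x, -, rfl⟩
    exact h (Opens.mem_top x)
  have h2 : U ≤ g ''ᵁ ⊤ := by rwa [Scheme.Hom.image_top_eq_opensRange]
  have h3 : IsIso (homOfLE h1) := ⟨homOfLE h2, Subsingleton.elim _ _, Subsingleton.elim _ _⟩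
  have h4 : IsIso (g.appLE U ⊤ h) := by
    have h5 : g.appLE U ⊤ h = X.presheaf.map (homOfLE h1).op ≫ (g.appIso ⊤).hom := by
      rw [← Scheme.Hom.appLE_appIso_inv g h, Category.assoc, Iso.inv_hom_id, Category.comp_id]
    rw [h5]
    infer_instance
  exact (ConcreteCategory.isIso_iff_bijective
    (g.appLE U ⊤ h ≫ (Scheme.ΓSpecIso T).hom)).1 inferInstance

end Evaluation

/-! ### The two embeddings of functions into functions on the neighbourhood -/

section Geometry

open TensorProduct

variable {S X : Scheme.{u}} (f : X ⟶ S)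

/-- The open subset `U × U` of `X × X`. -/
def squareOpen (U : X.Opens) : (pullback f f).Opens :=
  pullback.fst f f ⁻¹ᵁ U ⊓ pullback.snd f f ⁻¹ᵁ U

variable [IsSeparated f]

theorem preimage_firstProj_eq (U : X.Opens) : firstProj f 1 ⁻¹ᵁ U = secondProj f 1 ⁻¹ᵁ U := by
  ext x
  have := congr($(firstProj_base_eq f 1) x)
  change firstProj f 1 x ∈ U ↔ secondProj f 1 x ∈ U
  rw [show firstProj f 1 x = secondProj f 1 x from this]

theorem preimage_squareOpen (U : X.Opens) :
    diagonalNeighborhoodι f 1 ⁻¹ᵁ squareOpen f U = firstProj f 1 ⁻¹ᵁ U := by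
  change firstProj f 1 ⁻¹ᵁ U ⊓ secondProj f 1 ⁻¹ᵁ U = firstProj f 1 ⁻¹ᵁ U
  rw [← preimage_firstProj_eq, inf_idem]

/-- The ring homomorphism through which functions on `U` act from the left on functions on the part
of `X^1` over `U`. -/
def leftHom (U : X.Opens) : Γ(X, U) →+* Γ(diagonalNeighborhood f 1, firstProj f 1 ⁻¹ᵁ U) :=
  ((firstProj f 1).app U).hom

/-- The ring homomorphism through which functions on `U` act from the right on functions on the part
of `X^1` over `U`. -/
def rightHom (U : X.Opens) : Γ(X, U) →+* Γ(diagonalNeighborhood f 1, firstProj f 1 ⁻¹ᵁ U) :=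
  ((secondProj f 1).appLE U _ (preimage_firstProj_eq f U).le).hom

/-- The differential `dt = 1 ⊗ t - t ⊗ 1` of a function `t`, as a function on `X^1`. -/
def diff {U : X.Opens} (t : Γ(X, U)) : Γ(diagonalNeighborhood f 1, firstProj f 1 ⁻¹ᵁ U) :=
  rightHom f U t - leftHom f U t

omit [IsSeparated f] in
theorem leftHom_resO {V U : X.Opens} (h : V ≤ U) (a : Γ(X, U)) :
    leftHom f V (resO X h a) =
      resO (diagonalNeighborhood f 1) ((firstProj f 1).preimage_mono h) (leftHom f U a) :=
  congr($((firstProj f 1).naturality (homOfLE h).op) a)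

theorem rightHom_resO {V U : X.Opens} (h : V ≤ U) (a : Γ(X, U)) :
    rightHom f V (resO X h a) =
      resO (diagonalNeighborhood f 1) ((firstProj f 1).preimage_mono h) (rightHom f U a) := by
  have h1 := (secondProj f 1).map_appLE (preimage_firstProj_eq f V).le (homOfLE h).op
  have h2 := (secondProj f 1).appLE_map (preimage_firstProj_eq f U).le
    (homOfLE ((firstProj f 1).preimage_mono h)).op
  exact congr($(h1.trans h2.symm) a)

theorem diff_resO {V U : X.Opens} (h : V ≤ U) (a : Γ(X, U)) :
    diff f (resO X h a) =
      resO (diagonalNeighborhood f 1) ((firstProj f 1).preimage_mono h) (diff f a) := by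
  rw [diff, diff, leftHom_resO, rightHom_resO, map_sub]

end Geometry

/-! ### The neighbourhood of the diagonal over an affine open subset -/

section AffineGeometry

theorem top_le_preimage_comp {Z Y X : Scheme.{u}} (g : Z ⟶ Y) (m : Y ⟶ X) {W : Y.Opens}
    {U : X.Opens} (h : ⊤ ≤ g ⁻¹ᵁ W) (e : W ≤ m ⁻¹ᵁ U) : ⊤ ≤ (g ≫ m) ⁻¹ᵁ U :=
  fun _ hx => e (h hx)

open TensorProduct

variable {R : Type u} [CommRing R] {X : Scheme.{u}} (f : X ⟶ Spec (.of R))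
  {U : X.Opens} (hU : IsAffineOpen U) [Algebra R Γ(X, U)]

include hU in
/-- Over an affine base, `U × U` is the spectrum of `A ⊗ A`, where `A` is the ring of functions on
the affine open subset `U`. -/
theorem exists_square_chart
    (hf : hU.fromSpec ≫ f = Spec.map (CommRingCat.ofHom (algebraMap R Γ(X, U)))) :
    ∃ k : Spec (.of (Γ(X, U) ⊗[R] Γ(X, U))) ⟶ pullback f f,
      k ≫ pullback.fst f f =
        Spec.map (CommRingCat.ofHom Algebra.TensorProduct.includeLeftRingHom) ≫ hU.fromSpec ∧
      k ≫ pullback.snd f f =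
        Spec.map (CommRingCat.ofHom (R := Γ(X, U)) (S := Γ(X, U) ⊗[R] Γ(X, U))
          (RingHomClass.toRingHom Algebra.TensorProduct.includeRight)) ≫ hU.fromSpec ∧
      ∃ _ : IsOpenImmersion k, k.opensRange = squareOpen f U := by
  have hf' : Spec.map (CommRingCat.ofHom (algebraMap R Γ(X, U))) ≫ 𝟙 _ = hU.fromSpec ≫ f := by
    rw [hf]
    exact Category.comp_id _
  obtain ⟨m, hm⟩ : ∃ m, m = pullback.map _ _ f f hU.fromSpec hU.fromSpec (𝟙 _) hf' hf' := ⟨_, rfl⟩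
  have hm1 : m ≫ pullback.fst f f = pullback.fst _ _ ≫ hU.fromSpec := by
    rw [hm]
    exact pullback.lift_fst _ _ _
  have hm2 : m ≫ pullback.snd f f = pullback.snd _ _ ≫ hU.fromSpec := by
    rw [hm]
    exact pullback.lift_snd _ _ _
  have hm3 : IsOpenImmersion m := by
    rw [hm]
    infer_instance
  have hm4 : m.opensRange = squareOpen f U := by
    ext x
    have h2 := Scheme.Pullback.range_map (Spec.map (CommRingCat.ofHom (algebraMap R Γ(X, U))))
      (Spec.map (CommRingCat.ofHom (algebraMap R Γ(X, U)))) f f hU.fromSpec hU.fromSpec (𝟙 _)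
      hf' hf'
    rw [← hm, hU.range_fromSpec] at h2
    exact Set.ext_iff.1 h2 x
  refine ⟨(pullbackSpecIso R Γ(X, U) Γ(X, U)).inv ≫ m, ?_, ?_, inferInstance, ?_⟩
  · rw [Category.assoc, hm1]
    exact pullbackSpecIso_inv_fst_assoc _ _ _ _
  · rw [Category.assoc, hm2]
    exact pullbackSpecIso_inv_snd_assoc _ _ _ _
  · rw [← hm4]
    exact Scheme.Hom.opensRange_comp_of_isIso _ _

theorem le_preimage_diagonal {S X : Scheme.{u}} (f : X ⟶ S) (U : X.Opens) :
    U ≤ pullback.diagonal f ⁻¹ᵁ squareOpen f U := by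
  intro x hx
  refine ⟨?_, ?_⟩
  · change pullback.fst f f (pullback.diagonal f x) ∈ U
    rw [← Scheme.Hom.comp_apply]
    simpa using hx
  · change pullback.snd f f (pullback.diagonal f x) ∈ U
    rw [← Scheme.Hom.comp_apply]
    simpa using hx

/-- Functions on `U × U` are the elements of `A ⊗ A`, and restriction to the diagonal is
multiplication. -/
theorem exists_square_equiv
    (hf : hU.fromSpec ≫ f = Spec.map (CommRingCat.ofHom (algebraMap R Γ(X, U)))) :
    IsAffineOpen (squareOpen f U) ∧
    ∃ e : Γ(pullback f f, squareOpen f U) ≃+* Γ(X, U) ⊗[R] Γ(X, U),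
      (∀ a, e (((pullback.fst f f).appLE U (squareOpen f U) inf_le_left).hom a) = a ⊗ₜ 1) ∧
      (∀ a, e (((pullback.snd f f).appLE U (squareOpen f U) inf_le_right).hom a) = 1 ⊗ₜ a) ∧
      ∀ z, Algebra.TensorProduct.lmul' R (S := Γ(X, U)) (e z) =
        ((pullback.diagonal f).appLE (squareOpen f U) U (le_preimage_diagonal f U)).hom z := by
  obtain ⟨k, hk1, hk2, hkopen, hWeq⟩ := exists_square_chart f hU hf
  have htop : ⊤ ≤ k ⁻¹ᵁ squareOpen f U := by
    rw [← hWeq, Scheme.Hom.preimage_opensRange]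
  have hU' : ⊤ ≤ hU.fromSpec ⁻¹ᵁ U := hU.fromSpec_preimage_self.ge
  refine ⟨hWeq ▸ isAffineOpen_opensRange k,
    RingEquiv.ofBijective (evalPoint k htop) (bijective_evalPoint k htop hWeq.ge),
    fun a => ?_, fun a => ?_, fun z => ?_⟩
  · have h1 := evalPoint_appLE k (pullback.fst f f) inf_le_left htop
      (htop.trans (k.preimage_mono inf_le_left)) a
    refine h1.trans ((evalPoint_congr hk1 _ (top_le_preimage_comp _ _ le_top hU') a).trans ?_)
    refine (evalPoint_specMap _ _ hU' _ a).trans ?_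
    rw [evalPoint_fromSpec]
    rfl
  · have h1 := evalPoint_appLE k (pullback.snd f f) inf_le_right htop
      (htop.trans (k.preimage_mono inf_le_right)) a
    refine h1.trans ((evalPoint_congr hk2 _ (top_le_preimage_comp _ _ le_top hU') a).trans ?_)
    refine (evalPoint_specMap _ _ hU' _ a).trans ?_
    rw [evalPoint_fromSpec]
    rfl
  · have hd : Spec.map (CommRingCat.ofHom
        (Algebra.TensorProduct.lmul' R (S := Γ(X, U))).toRingHom) ≫ k =
        hU.fromSpec ≫ pullback.diagonal f := by
      apply pullback.hom_ext
      · rw [Category.assoc, hk1, Category.assoc, pullback.diagonal_fst, Category.comp_id,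
          ← Spec.map_comp_assoc, ← CommRingCat.ofHom_comp]
        have : (Algebra.TensorProduct.lmul' R (S := Γ(X, U))).toRingHom.comp
            Algebra.TensorProduct.includeLeftRingHom = RingHom.id _ := by
          ext a
          simp
        rw [this]
        exact (congrArg (· ≫ hU.fromSpec) (Spec.map_id _)).trans (Category.id_comp _)
      · rw [Category.assoc, hk2, Category.assoc, pullback.diagonal_snd, Category.comp_id,
          ← Spec.map_comp_assoc, ← CommRingCat.ofHom_comp]
        have : (Algebra.TensorProduct.lmul' R (S := Γ(X, U))).toRingHom.comp
            (RingHomClass.toRingHom Algebra.TensorProduct.includeRight) = RingHom.id _ := by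
          ext a
          simp
        rw [this]
        exact (congrArg (· ≫ hU.fromSpec) (Spec.map_id _)).trans (Category.id_comp _)
    have h1 := evalPoint_specMap (CommRingCat.ofHom
        (Algebra.TensorProduct.lmul' R (S := Γ(X, U))).toRingHom) k htop
        (top_le_preimage_comp _ _ le_top htop) z
    have h2 := evalPoint_appLE hU.fromSpec (pullback.diagonal f) (le_preimage_diagonal f U) hU'
      (top_le_preimage_comp _ _ hU' (le_preimage_diagonal f U)) z
    rw [evalPoint_fromSpec] at h2
    exact h1.symm.trans ((evalPoint_congr hd _ _ z).trans h2.symm)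

omit [Algebra R Γ(X, U)] in
/-- Functions on `X^1` over `U` are functions on `U × U` modulo the square of the ideal of the
diagonal. -/
theorem appLE_diagonalNeighborhoodι (hW : IsAffineOpen (squareOpen f U))
    (V : (diagonalNeighborhood f 1).Opens) (h : diagonalNeighborhoodι f 1 ⁻¹ᵁ squareOpen f U = V) :
    Function.Surjective ((diagonalNeighborhoodι f 1).appLE (squareOpen f U) V h.ge).hom ∧
    RingHom.ker ((diagonalNeighborhoodι f 1).appLE (squareOpen f U) V h.ge).hom =
      (pullback.diagonal f).ker.ideal ⟨_, hW⟩ ^ 2 ∧ IsAffineOpen V := by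
  subst h
  rw [Scheme.Hom.appLE_eq_app]
  exact ⟨((pullback.diagonal f).ker ^ (1 + 1)).subschemeι_app_surjective ⟨_, hW⟩,
    ((pullback.diagonal f).ker ^ (1 + 1)).ker_subschemeι_app ⟨_, hW⟩,
    hW.preimage ((pullback.diagonal f).ker ^ (1 + 1)).subschemeι⟩

omit [Algebra R Γ(X, U)] in
theorem mem_ker_diagonal_iff [IsSeparated f] (hW : IsAffineOpen (squareOpen f U))
    (z : Γ(pullback f f, squareOpen f U)) :
    z ∈ (pullback.diagonal f).ker.ideal ⟨_, hW⟩ ↔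
      ((pullback.diagonal f).appLE (squareOpen f U) U (le_preimage_diagonal f U)).hom z = 0 := by
  have : ∀ (V : X.Opens) (h : pullback.diagonal f ⁻¹ᵁ squareOpen f U = V),
      z ∈ (pullback.diagonal f).ker.ideal ⟨_, hW⟩ ↔
      ((pullback.diagonal f).appLE (squareOpen f U) V h.ge).hom z = 0 := by
    rintro _ rfl
    rw [Scheme.Hom.appLE_eq_app, Scheme.Hom.ker_apply]
    rfl
  refine this U (le_antisymm ?_ (le_preimage_diagonal f U))
  intro x hx
  have h1 : pullback.fst f f (pullback.diagonal f x) ∈ U := hx.1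
  rw [← Scheme.Hom.comp_apply] at h1
  simpa using h1

/-- The description of `X^1` over an affine open subset `U` as the spectrum of the quotient of
`A ⊗ A` by the square of the diagonal ideal, where `A` is the ring of functions on `U`. -/
theorem exists_presentation [IsSeparated f]
    (hf : hU.fromSpec ≫ f = Spec.map (CommRingCat.ofHom (algebraMap R Γ(X, U)))) :
    ∃ (π : Γ(X, U) ⊗[R] Γ(X, U) →+* Γ(diagonalNeighborhood f 1, firstProj f 1 ⁻¹ᵁ U))
      (K : Ideal (Γ(X, U) ⊗[R] Γ(X, U))),
      Function.Surjective π ∧ K ≤ RingHom.ker (Algebra.TensorProduct.lmul' R (S := Γ(X, U))) ∧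
      (∀ a, 1 ⊗ₜ a - a ⊗ₜ 1 ∈ K) ∧ RingHom.ker π = K ^ 2 ∧
      (∀ a, π (a ⊗ₜ 1) = leftHom f U a) ∧ (∀ a, π (1 ⊗ₜ a) = rightHom f U a) ∧
      IsAffineOpen (firstProj f 1 ⁻¹ᵁ U) := by
  obtain ⟨hW, e, he1, he2, hD⟩ := exists_square_equiv f hU hf
  have hV := preimage_squareOpen f U
  obtain ⟨hρs, hρk, hVa⟩ := appLE_diagonalNeighborhoodι f hW _ hV
  have hl : ∀ a, ((diagonalNeighborhoodι f 1).appLE (squareOpen f U) _ hV.ge).hom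
      (((pullback.fst f f).appLE U (squareOpen f U) inf_le_left).hom a) = leftHom f U a :=
    fun a => by
      have h1 := (diagonalNeighborhoodι f 1).appLE_comp_appLE (pullback.fst f f) U
        (squareOpen f U) _ inf_le_left hV.ge
      have h2 := (firstProj f 1).appLE_eq_app (U := U)
      exact congr($(h1.trans h2) a)
  have hr : ∀ a, ((diagonalNeighborhoodι f 1).appLE (squareOpen f U) _ hV.ge).hom
      (((pullback.snd f f).appLE U (squareOpen f U) inf_le_right).hom a) = rightHom f U a :=
    fun a => by
      have h1 := (diagonalNeighborhoodι f 1).appLE_comp_appLE (pullback.snd f f) U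
        (squareOpen f U) _ inf_le_right hV.ge
      exact congr($h1 a)
  generalize ((diagonalNeighborhoodι f 1).appLE (squareOpen f U) _ hV.ge).hom = ρ
    at hρs hρk hl hr
  have hI := mem_ker_diagonal_iff f hW
  have hd : ∀ a, ((pullback.snd f f).appLE U (squareOpen f U) inf_le_right).hom a -
      ((pullback.fst f f).appLE U (squareOpen f U) inf_le_left).hom a ∈
      (pullback.diagonal f).ker.ideal ⟨_, hW⟩ := fun a => by
    rw [hI, ← hD, map_sub, map_sub, he1, he2]
    simp
  generalize (pullback.diagonal f).ker.ideal ⟨_, hW⟩ = I at hρk hI hd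
  refine ⟨ρ.comp e.symm.toRingHom, I.map e.toRingHom, hρs.comp e.symm.surjective, ?_, ?_, ?_,
    fun a => ?_, fun a => ?_, hVa⟩
  · rw [Ideal.map_le_iff_le_comap]
    intro z hz
    exact (hD z).trans ((hI z).1 hz)
  · intro a
    rw [← he1, ← he2, ← map_sub]
    exact Ideal.mem_map_of_mem e.toRingHom (hd a)
  · rw [← Ideal.map_pow, ← hρk]
    ext w
    obtain ⟨z, rfl⟩ := e.surjective w
    have h1 := Ideal.mem_map_of_equiv e (I := RingHom.ker ρ) (e z)
    refine Iff.trans ?_ h1.symm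
    constructor
    · intro h
      exact ⟨z, by simpa [RingHom.mem_ker] using h, rfl⟩
    · rintro ⟨y, hy, h⟩
      rw [e.injective h] at hy
      simpa [RingHom.mem_ker] using hy
  · rw [← he1, ← hl]
    exact congrArg ρ (e.symm_apply_apply _)
  · rw [← he2, ← hr]
    exact congrArg ρ (e.symm_apply_apply _)

end AffineGeometry

/-! ### The basis `1`, `dt` -/

section Basis

open TensorProduct

theorem isLocalization_resO {X : Scheme.{u}} {U : X.Opens} (hU : IsAffineOpen U) (s : Γ(X, U))
    {W : X.Opens} (hW : X.basicOpen s = W) (h : W ≤ U) :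
    letI := (resO X h).toAlgebra
    IsLocalization.Away s Γ(X, W) := by
  subst hW
  exact hU.isLocalization_basicOpen s

/-- A basis `1, ξ` of the functions on `X^1` over an affine open set remains a basis over the basic
open subsets. -/
theorem bijective_basicOpen {X Y : Scheme.{u}} {U W : X.Opens} {U' W' : Y.Opens}
    (hU : IsAffineOpen U) (hU' : IsAffineOpen U') (g : Γ(X, U)) (hW : X.basicOpen g = W)
    (l : Γ(X, U) →+* Γ(Y, U')) (hW' : Y.basicOpen (l g) = W') (l' : Γ(X, W) →+* Γ(Y, W'))
    (h : W ≤ U) (h' : W' ≤ U') (hl : ∀ a, l' (resO X h a) = resO Y h' (l a)) (ξ : Γ(Y, U'))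
    (hξ : Function.Bijective fun a : Γ(X, U) × Γ(X, U) => l a.1 + l a.2 * ξ) :
    Function.Bijective fun a : Γ(X, W) × Γ(X, W) => l' a.1 + l' a.2 * resO Y h' ξ := by
  let i1 := (resO X h).toAlgebra
  let i2 := (resO Y h').toAlgebra
  have h1 := isLocalization_resO hU g hW h
  have h2 := isLocalization_resO hU' (l g) hW' h'
  exact bijective_localization (A' := Γ(X, W)) (B' := Γ(Y, W')) g l l' hl ξ hξ

variable {R : Type u} [CommRing R] {X : Scheme.{u}} (f : X ⟶ Spec (.of R))
  {U : X.Opens} (hU : IsAffineOpen U) [Algebra R Γ(X, U)] [IsSeparated f]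

include hU in
theorem diff_mul_diff
    (hf : hU.fromSpec ≫ f = Spec.map (CommRingCat.ofHom (algebraMap R Γ(X, U))))
    (a b : Γ(X, U)) : diff f a * diff f b = 0 := by
  obtain ⟨π, K, -, -, hd, hker, hl, hr, -⟩ := exists_presentation f hU hf
  have h1 : (1 ⊗ₜ a - a ⊗ₜ 1) * (1 ⊗ₜ b - b ⊗ₜ 1) ∈ RingHom.ker π := by
    rw [hker, pow_two]
    exact Ideal.mul_mem_mul (hd a) (hd b)
  rw [RingHom.mem_ker, map_mul, map_sub, map_sub, hl, hl, hr, hr] at h1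
  exact h1

include hU in
/-- If `t` is a coordinate on `U`, then `1, dt` is a basis of the functions on `X^1` as a left
module, over every basic open subset of `U`. -/
theorem bijective_leftHom
    (hf : hU.fromSpec ≫ f = Spec.map (CommRingCat.ofHom (algebraMap R Γ(X, U))))
    {t : Γ(X, U)} (ht : Function.Bijective (Polynomial.aeval (R := R) t)) (g : Γ(X, U)) :
    Function.Bijective fun a : Γ(X, X.basicOpen g) × Γ(X, X.basicOpen g) =>
      leftHom f _ a.1 + leftHom f _ a.2 * diff f (resO X (X.basicOpen_le g) t) := by
  obtain ⟨π, K, hs, hK, hd, hker, hl, hr, ha⟩ := exists_presentation f hU hf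
  have h0 := bijective_principalParts ht π hs K hK (hd t) hker
  simp only [hl, hr] at h0
  rw [diff_resO]
  refine bijective_basicOpen hU ha g rfl (leftHom f U) ?_ (leftHom f _) (X.basicOpen_le g) _
    (leftHom_resO f _) (diff f t) h0
  exact (Scheme.preimage_basicOpen _ _).symm

include hU in
/-- If `t` is a coordinate on `U`, then `1, dt` is a basis of the functions on `X^1` as a right
module, over every basic open subset of `U`. -/
theorem bijective_rightHom
    (hf : hU.fromSpec ≫ f = Spec.map (CommRingCat.ofHom (algebraMap R Γ(X, U))))
    {t : Γ(X, U)} (ht : Function.Bijective (Polynomial.aeval (R := R) t)) (g : Γ(X, U)) :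
    Function.Bijective fun a : Γ(X, X.basicOpen g) × Γ(X, X.basicOpen g) =>
      rightHom f _ a.1 + rightHom f _ a.2 * diff f (resO X (X.basicOpen_le g) t) := by
  obtain ⟨π, K, hs, hK, hd, hker, hl, hr, ha⟩ := exists_presentation f hU hf
  have h0 := bijective_principalParts ht π hs K hK (hd t) hker
  simp only [hl, hr] at h0
  have h1 := bijective_right_of_left (leftHom f U) (rightHom f U) (diff f t)
    (fun a => diff_mul_diff f hU hf a t) (diff_mul_diff f hU hf t t) h0
  rw [diff_resO]
  refine bijective_basicOpen hU ha g rfl (rightHom f U) ?_ (rightHom f _) (X.basicOpen_le g) _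
    (rightHom_resO f _) (diff f t) h1
  have : ∀ (V : (diagonalNeighborhood f 1).Opens) (h : V = secondProj f 1 ⁻¹ᵁ U),
      (diagonalNeighborhood f 1).basicOpen (((secondProj f 1).appLE U V h.le).hom g) =
        secondProj f 1 ⁻¹ᵁ X.basicOpen g := by
    rintro _ rfl
    rw [Scheme.Hom.appLE_eq_app]
    exact (Scheme.preimage_basicOpen _ _).symm
  exact (this _ (preimage_firstProj_eq f U)).trans (preimage_firstProj_eq f _).symm

end Basis

/-! ### Generators and transition functions of twisting sheaves -/

section Twist

variable {A σ : Type u} [CommRing A] [SetLike σ A] [AddSubgroupClass σ A]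
variable (𝒜 : ℕ → σ) [GradedRing 𝒜]

/-- The value at a point of a function on an open subset of `Proj 𝒜`, in the localization. -/
def evalAt {U : (Proj 𝒜).Opens} (x : ProjectiveSpectrum 𝒜) (hx : x ∈ U) :
    Γ(Proj 𝒜, U) →+* LocalizationAt 𝒜 x where
  toFun a := HomogeneousLocalization.val
    ((show (ProjectiveSpectrum.Proj.structureSheaf 𝒜).1.obj (op U) from a).1 ⟨x, hx⟩)
  map_one' := HomogeneousLocalization.val_one
  map_mul' _ _ := HomogeneousLocalization.val_mul _ _
  map_zero' := HomogeneousLocalization.val_zero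
  map_add' _ _ := HomogeneousLocalization.val_add _ _

theorem evalAt_resO {V U : (Proj 𝒜).Opens} (h : V ≤ U) (a : Γ(Proj 𝒜, U))
    (x : ProjectiveSpectrum 𝒜) (hx : x ∈ V) :
    evalAt 𝒜 x hx (resO (Proj 𝒜) h a) = evalAt 𝒜 x (h hx) a := rfl

theorem eq_of_evalAt_eq {U : (Proj 𝒜).Opens} {a b : Γ(Proj 𝒜, U)}
    (h : ∀ (x : ProjectiveSpectrum 𝒜) (hx : x ∈ U), evalAt 𝒜 x hx a = evalAt 𝒜 x hx b) :
    a = b :=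
  Subtype.ext (funext fun x => HomogeneousLocalization.val_injective _ (h x.1 x.2))

/-- A function whose values are locally given by fractions of degree `0` is a section of the
structure sheaf. -/
theorem exists_section {U : (Proj 𝒜).Opens} (z : ∀ x : U, LocalizationAt 𝒜 x.1)
    (hz : (isLocallyTwistedFraction 𝒜 0).pred z) :
    ∃ a : Γ(Proj 𝒜, U), ∀ x : U, evalAt 𝒜 x.1 x.2 a = z x := by
  have h1 : ∀ (x : ProjectiveSpectrum 𝒜) (hx : x ∈ U),
      ∃ a : HomogeneousLocalization.AtPrime 𝒜 x.asHomogeneousIdeal.toIdeal,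
        HomogeneousLocalization.val a = z ⟨x, hx⟩ := fun x hx => by
    obtain ⟨V, hxV, i, n, j, hnj, r, s, hs, h⟩ := hz ⟨x, hx⟩
    obtain rfl : n = j := by omega
    exact ⟨.mk ⟨n, r, s, hs ⟨x, hxV⟩⟩, (h ⟨x, hxV⟩).symm⟩
  choose a ha using h1
  refine ⟨⟨fun x => a x.1 x.2, fun x => ?_⟩, fun x => ha x.1 x.2⟩
  obtain ⟨V, hx, i, n, j, hnj, r, s, hs, h⟩ := hz x
  obtain rfl : n = j := by omega
  refine ⟨V, hx, i, n, r, s, hs, fun y => HomogeneousLocalization.val_injective _ ?_⟩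
  exact (ha _ (i.le y.2)).trans (h y)

variable {𝒜} {d : ℤ}

/-- The value at a point of a section of `O(d)`. -/
def twistEvalAt {U : (Proj 𝒜).Opens} (x : ProjectiveSpectrum 𝒜) (hx : x ∈ U)
    (m : Γ(twist 𝒜 d, U)) : LocalizationAt 𝒜 x :=
  (show twistSections 𝒜 d (op U) from m).1 ⟨x, hx⟩

theorem twistEvalAt_smul {U : (Proj 𝒜).Opens} (x : ProjectiveSpectrum 𝒜) (hx : x ∈ U)
    (a : Γ(Proj 𝒜, U)) (m : Γ(twist 𝒜 d, U)) :
    twistEvalAt x hx (a • m) = evalAt 𝒜 x hx a * twistEvalAt x hx m := rfl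

theorem twistEvalAt_res {V U : (Proj 𝒜).Opens} (h : V ≤ U) (m : Γ(twist 𝒜 d, U))
    (x : ProjectiveSpectrum 𝒜) (hx : x ∈ V) :
    twistEvalAt x hx (res (twist 𝒜 d) h m) = twistEvalAt x (h hx) m := rfl

theorem eq_of_twistEvalAt_eq {U : (Proj 𝒜).Opens} {m m' : Γ(twist 𝒜 d, U)}
    (h : ∀ (x : ProjectiveSpectrum 𝒜) (hx : x ∈ U), twistEvalAt x hx m = twistEvalAt x hx m') :
    m = m' :=
  Subtype.ext (funext fun x => h x.1 x.2)

theorem isLocallyTwistedFraction_mul {d e c : ℤ} (hc : d + e = c)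
    {U : Opens (ProjectiveSpectrum.top 𝒜)}
    {a b : ∀ x : U, LocalizationAt 𝒜 x.1} (ha : (isLocallyTwistedFraction 𝒜 d).pred a)
    (hb : (isLocallyTwistedFraction 𝒜 e).pred b) :
    (isLocallyTwistedFraction 𝒜 c).pred (fun x => a x * b x) := fun x => by
  obtain ⟨Va, ma, ia, na, ja, ea, ⟨ra, hra⟩, ⟨sa, hsa⟩, ka, wa⟩ := ha x
  obtain ⟨Vb, mb, ib, nb, jb, eb, ⟨rb, hrb⟩, ⟨sb, hsb⟩, kb, wb⟩ := hb x
  refine ⟨Va ⊓ Vb, ⟨ma, mb⟩, Opens.infLELeft _ _ ≫ ia, na + nb, ja + jb, by push_cast; omega,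
    ⟨ra * rb, SetLike.mul_mem_graded hra hrb⟩, ⟨sa * sb, SetLike.mul_mem_graded hsa hsb⟩,
    fun y => ?_, fun y => ?_⟩
  · exact fun h => (ProjectiveSpectrum.isPrime y.1).mem_or_mem h |>.elim
      (ka ⟨y.1, y.2.1⟩) (kb ⟨y.1, y.2.2⟩)
  · refine (congrArg₂ (· * ·) (wa ⟨y.1, y.2.1⟩) (wb ⟨y.1, y.2.2⟩)).trans ?_
    exact Localization.mk_mul _ _ _ _

/-- An element of `A` as a unit in the localization at a point where it does not vanish. -/
def unitAt (f : A) (x : ProjectiveSpectrum 𝒜) (hx : x ∈ Proj.basicOpen 𝒜 f) :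
    (LocalizationAt 𝒜 x)ˣ :=
  (IsLocalization.map_units (LocalizationAt 𝒜 x)
    (⟨f, hx⟩ : x.asHomogeneousIdeal.toIdeal.primeCompl)).unit

theorem val_unitAt (f : A) (x : ProjectiveSpectrum 𝒜) (hx : x ∈ Proj.basicOpen 𝒜 f) :
    (unitAt f x hx : LocalizationAt 𝒜 x) = algebraMap A _ f := rfl

theorem isLocallyTwistedFraction_zpow {f : A} (hf : f ∈ 𝒜 1) (d : ℤ) {U : (Proj 𝒜).Opens}
    (hU : U ≤ Proj.basicOpen 𝒜 f) :
    (isLocallyTwistedFraction 𝒜 d).pred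
      (fun x : U => ((unitAt f x.1 (hU x.2) ^ d : (LocalizationAt 𝒜 x.1)ˣ) :
        LocalizationAt 𝒜 x.1)) := fun x => by
  have hpow : ∀ k : ℕ, f ^ k ∈ 𝒜 k := fun k => by
    simpa using SetLike.pow_mem_graded k hf
  refine ⟨U, x.2, 𝟙 U, d.toNat, (-d).toNat, by omega, ⟨f ^ d.toNat, hpow _⟩,
    ⟨f ^ (-d).toNat, hpow _⟩, fun y hy => hU y.2 (y.1.isPrime.mem_of_pow_mem _ hy), fun y => ?_⟩
  rw [Localization.mk_eq_mk']
  refine IsLocalization.eq_mk'_iff_mul_eq.2 ?_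
  change _ * algebraMap A _ (f ^ (-d).toNat) = algebraMap A _ (f ^ d.toNat)
  rw [map_pow, map_pow]
  change _ * (unitAt f y.1 (hU y.2) : LocalizationAt 𝒜 y.1) ^ _ =
    (unitAt f y.1 (hU y.2) : LocalizationAt 𝒜 y.1) ^ _
  rw [← Units.val_pow_eq_pow_val, ← Units.val_pow_eq_pow_val]
  refine (Units.val_mul _ _).symm.trans (congrArg Units.val ?_)
  change unitAt f y.1 (hU y.2) ^ d * _ = _
  rw [← zpow_natCast, ← zpow_natCast, ← zpow_add]
  congr 1
  omega

/-- The section `f ^ d` of `O(d)` over the locus where the linear form `f` does not vanish. -/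
def twistPow {f : A} (hf : f ∈ 𝒜 1) (d : ℤ) : Γ(twist 𝒜 d, Proj.basicOpen 𝒜 f) :=
  (⟨fun x => ((unitAt f x.1 x.2 ^ d : (LocalizationAt 𝒜 x.1)ˣ) : LocalizationAt 𝒜 x.1),
    isLocallyTwistedFraction_zpow hf d le_rfl⟩ :
    twistSections 𝒜 d (op (Proj.basicOpen 𝒜 f)))

theorem twistEvalAt_twistPow {f : A} (hf : f ∈ 𝒜 1) (d : ℤ) (x : ProjectiveSpectrum 𝒜)
    (hx : x ∈ Proj.basicOpen 𝒜 f) :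
    twistEvalAt x hx (twistPow hf d) = ((unitAt f x hx ^ d : (LocalizationAt 𝒜 x)ˣ) :
      LocalizationAt 𝒜 x) := rfl

/-- `O(d)` is free on `f ^ d` where the linear form `f` does not vanish. -/
theorem isGenerator_twistPow {f : A} (hf : f ∈ 𝒜 1) (d : ℤ) :
    IsGenerator (twist 𝒜 d) (twistPow hf d) := fun W h => by
  constructor
  · intro a b hab
    refine eq_of_evalAt_eq 𝒜 fun x hx => ?_
    have h1 := congrArg (twistEvalAt x hx) hab
    change twistEvalAt x hx (a • _) = twistEvalAt x hx (b • _) at h1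
    rw [twistEvalAt_smul, twistEvalAt_smul, twistEvalAt_res, twistEvalAt_twistPow _ _ _ (h hx)]
      at h1
    exact (Units.isUnit _).mul_right_cancel h1
  · intro m
    obtain ⟨a, ha⟩ := exists_section 𝒜 _ (isLocallyTwistedFraction_mul (add_neg_cancel d)
      (show twistSections 𝒜 d (op W) from m).2 (isLocallyTwistedFraction_zpow hf (-d) h))
    refine ⟨a, eq_of_twistEvalAt_eq fun x hx => ?_⟩
    change twistEvalAt x hx (a • _) = _
    rw [twistEvalAt_smul, twistEvalAt_res, twistEvalAt_twistPow _ _ _ (h hx), ha ⟨x, hx⟩]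
    change twistEvalAt x hx m * _ * _ = _
    rw [mul_assoc]
    have : ((unitAt f x (h hx) ^ (-d) : (LocalizationAt 𝒜 x)ˣ) : LocalizationAt 𝒜 x) *
        ((unitAt f x (h hx) ^ d : (LocalizationAt 𝒜 x)ˣ) : LocalizationAt 𝒜 x) = 1 := by
      rw [← Units.val_mul, ← zpow_add, neg_add_cancel, zpow_zero, Units.val_one]
    exact (congrArg _ this).trans (mul_one _)

/-- The quotient `g / f` of linear forms, as a function where `f` does not vanish. -/
def ratio {f g : A} (hf : f ∈ 𝒜 1) (hg : g ∈ 𝒜 1) : Γ(Proj 𝒜, Proj.basicOpen 𝒜 f) :=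
  (Proj.awayToSection 𝒜 f).hom
    (HomogeneousLocalization.Away.mk 𝒜 hf 1 g (by simpa using hg))

theorem evalAt_ratio_mul {f g : A} (hf : f ∈ 𝒜 1) (hg : g ∈ 𝒜 1) (x : ProjectiveSpectrum 𝒜)
    (hx : x ∈ Proj.basicOpen 𝒜 f) :
    evalAt 𝒜 x hx (ratio hf hg) * unitAt f x hx = algebraMap A _ g := by
  have h1 := ProjectiveSpectrum.Proj.awayToSection_apply 𝒜 f
    (HomogeneousLocalization.Away.mk 𝒜 hf 1 g (by simpa using hg)) ⟨x, hx⟩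
  have h2 : evalAt 𝒜 x hx (ratio hf hg) = _ := h1
  rw [h2, HomogeneousLocalization.Away.val_mk, Localization.mk_eq_mk', IsLocalization.map_mk',
    val_unitAt]
  have h3 := IsLocalization.mk'_spec (LocalizationAt 𝒜 x) g
    (⟨f, hx⟩ : x.asHomogeneousIdeal.toIdeal.primeCompl)
  rw [← h3]
  congr 1
  simp

theorem evalAt_ratio {f g : A} (hf : f ∈ 𝒜 1) (hg : g ∈ 𝒜 1) (x : ProjectiveSpectrum 𝒜)
    (hx : x ∈ Proj.basicOpen 𝒜 f) (hx' : x ∈ Proj.basicOpen 𝒜 g) :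
    evalAt 𝒜 x hx (ratio hf hg) = (unitAt g x hx' * (unitAt f x hx)⁻¹ : (LocalizationAt 𝒜 x)ˣ) := by
  rw [Units.val_mul, Units.eq_mul_inv_iff_mul_eq]
  exact evalAt_ratio_mul hf hg x hx

theorem ratio_mul_ratio {f g : A} (hf : f ∈ 𝒜 1) (hg : g ∈ 𝒜 1) {W : (Proj 𝒜).Opens}
    (hWf : W ≤ Proj.basicOpen 𝒜 f) (hWg : W ≤ Proj.basicOpen 𝒜 g) :
    resO (Proj 𝒜) hWf (ratio hf hg) * resO (Proj 𝒜) hWg (ratio hg hf) = 1 := by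
  refine eq_of_evalAt_eq 𝒜 fun x hx => ?_
  rw [map_mul, map_one, evalAt_resO, evalAt_resO, evalAt_ratio hf hg x _ (hWg hx),
    evalAt_ratio hg hf x _ (hWf hx), ← Units.val_mul]
  simp

/-- The transition functions of `O(d)`. -/
theorem res_twistPow {f g : A} (hf : f ∈ 𝒜 1) (hg : g ∈ 𝒜 1) {W : (Proj 𝒜).Opens}
    (hWf : W ≤ Proj.basicOpen 𝒜 f) (hWg : W ≤ Proj.basicOpen 𝒜 g) (T : Γ(Proj 𝒜, W)ˣ)
    (hT : (T : Γ(Proj 𝒜, W)) = resO (Proj 𝒜) hWf (ratio hf hg)) (d : ℤ) :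
    res (twist 𝒜 d) hWg (twistPow hg d) =
      ((T ^ d : Γ(Proj 𝒜, W)ˣ) : Γ(Proj 𝒜, W)) • res (twist 𝒜 d) hWf (twistPow hf d) := by
  refine eq_of_twistEvalAt_eq fun x hx => ?_
  rw [twistEvalAt_smul, twistEvalAt_res, twistEvalAt_res, twistEvalAt_twistPow _ _ _ (hWf hx),
    twistEvalAt_twistPow _ _ _ (hWg hx)]
  have h1 : Units.map (evalAt 𝒜 x hx : Γ(Proj 𝒜, W) →* LocalizationAt 𝒜 x) T =
      unitAt g x (hWg hx) * (unitAt f x (hWf hx))⁻¹ := by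
    ext
    rw [Units.coe_map]
    change evalAt 𝒜 x hx T = _
    rw [hT, evalAt_resO, evalAt_ratio hf hg x _ (hWg hx)]
  have h2 : evalAt 𝒜 x hx ((T ^ d : Γ(Proj 𝒜, W)ˣ) : Γ(Proj 𝒜, W)) =
      ((Units.map (evalAt 𝒜 x hx : Γ(Proj 𝒜, W) →* LocalizationAt 𝒜 x) T ^ d :
        (LocalizationAt 𝒜 x)ˣ) : LocalizationAt 𝒜 x) := by
    rw [← map_zpow]
    rfl
  rw [h2, h1, ← Units.val_mul, mul_zpow, inv_zpow, inv_mul_cancel_right]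

end Twist

/-! ### The charts of the projective line -/

section Chart

/-- The inclusion of the affine open subset `f ≠ 0` of `Proj 𝒜`, followed by the structure
morphism. -/
theorem fromSpec_basicOpen_toSpecZero {A σ : Type u} [CommRing A] [SetLike σ A]
    [AddSubgroupClass σ A] (𝒜 : ℕ → σ) [GradedRing 𝒜] {f : A} {m : ℕ} (hf : f ∈ 𝒜 m) (hm : 0 < m) :
    (Proj.isAffineOpen_basicOpen 𝒜 f hf hm).fromSpec ≫ Proj.toSpecZero 𝒜 =
      Spec.map (CommRingCat.ofHom (HomogeneousLocalization.fromZeroRingHom 𝒜 _) ≫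
        Proj.awayToSection 𝒜 f) := by
  have h1 : (Proj.isAffineOpen_basicOpen 𝒜 f hf hm).fromSpec =
      Spec.map (Proj.awayToSection 𝒜 f) ≫ Proj.awayι 𝒜 f hf hm := by
    rw [← cancel_epi (Proj.isAffineOpen_basicOpen 𝒜 f hf hm).isoSpec.hom,
      IsAffineOpen.isoSpec_hom_fromSpec, IsAffineOpen.isoSpec_hom, Proj.awayι, ← Category.assoc,
      ← Category.assoc]
    have h2 : (Proj.basicOpen 𝒜 f).toSpecΓ ≫ Spec.map (Proj.awayToSection 𝒜 f) =
        (Proj.basicOpenIsoSpec 𝒜 f hf hm).hom := (Proj.basicOpenIsoSpec_hom 𝒜 f hf hm).symm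
    rw [h2, Iso.hom_inv_id, Category.id_comp]
  rw [h1, Category.assoc, Proj.awayι_toSpecZero, Spec.map_comp]

attribute [local instance] MvPolynomial.gradedAlgebra

variable (F : Type u) [Field F]

/-- The grading of `F[x₀, x₁]` by degree. -/
abbrev lineGrading : ℕ → Submodule F (MvPolynomial (Fin 2) F) :=
  MvPolynomial.homogeneousSubmodule (Fin 2) F

theorem X_mem_lineGrading (i : Fin 2) : MvPolynomial.X i ∈ lineGrading F 1 :=
  MvPolynomial.isHomogeneous_X F i

/-- The constants in the functions on the open subset `x i ≠ 0` of the projective line. -/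
def constAway (i : Fin 2) :
    F →+* HomogeneousLocalization.Away (lineGrading F) (MvPolynomial.X i) :=
  (HomogeneousLocalization.fromZeroRingHom (lineGrading F) (.powers (MvPolynomial.X i))).comp
    (algebraMap F (lineGrading F 0))

theorem val_constAway (i : Fin 2) (c : F) :
    (constAway F i c).val = algebraMap (MvPolynomial (Fin 2) F) _ (MvPolynomial.C c) :=
  rfl

/-- The coordinate `x j / x i`. -/
def coordAway (i j : Fin 2) :
    HomogeneousLocalization.Away (lineGrading F) (MvPolynomial.X i) :=
  HomogeneousLocalization.Away.mk (lineGrading F) (X_mem_lineGrading F i) 1 (MvPolynomial.X j)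
    (by simpa using X_mem_lineGrading F j)

theorem val_coordAway_mul (i j : Fin 2) :
    (coordAway F i j).val * algebraMap (MvPolynomial (Fin 2) F) _ (MvPolynomial.X i) =
      algebraMap (MvPolynomial (Fin 2) F) (Localization.Away (MvPolynomial.X i))
        (MvPolynomial.X j) := by
  rw [coordAway, HomogeneousLocalization.Away.val_mk, Localization.mk_eq_mk']
  have := IsLocalization.mk'_spec (Localization.Away (MvPolynomial.X (R := F) i))
    (MvPolynomial.X (R := F) j)
    (⟨MvPolynomial.X i ^ 1, 1, rfl⟩ : Submonoid.powers (MvPolynomial.X (R := F) i))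
  rw [← this]
  congr 1
  simp

/-- Setting `x i = 1` and `x j = T` in a polynomial, `i ≠ j`. -/
def dehomogenize (i : Fin 2) : MvPolynomial (Fin 2) F →ₐ[F] Polynomial F :=
  MvPolynomial.aeval fun k => if k = i then 1 else Polynomial.X

/-- A homogeneous polynomial of degree `n` is recovered from its dehomogenization. -/
theorem val_eval₂_dehomogenize {i j : Fin 2} (hij : i ≠ j) {n : ℕ} {a : MvPolynomial (Fin 2) F}
    (ha : a ∈ lineGrading F n) :
    (Polynomial.eval₂ (constAway F i) (coordAway F i j) (dehomogenize F i a)).val *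
      algebraMap (MvPolynomial (Fin 2) F) _ (MvPolynomial.X i) ^ n =
      algebraMap (MvPolynomial (Fin 2) F) (Localization.Away (MvPolynomial.X i)) a := by
  obtain ⟨E, hE⟩ : ∃ E : MvPolynomial (Fin 2) F →+*
      Localization.Away (MvPolynomial.X (R := F) i), ∀ b, E b =
        (Polynomial.eval₂ (constAway F i) (coordAway F i j) (dehomogenize F i b)).val :=
    ⟨(algebraMap (HomogeneousLocalization.Away (lineGrading F) (MvPolynomial.X i))
      (Localization.Away (MvPolynomial.X (R := F) i))).comp
      ((Polynomial.eval₂RingHom (constAway F i) (coordAway F i j)).comp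
        (dehomogenize F i).toRingHom), fun b => rfl⟩
  have hC : ∀ c, E (MvPolynomial.C c) =
      algebraMap (MvPolynomial (Fin 2) F) _ (MvPolynomial.C c) := fun c => by
    rw [hE, dehomogenize, MvPolynomial.algHom_C, Polynomial.algebraMap_eq, Polynomial.eval₂_C,
      val_constAway]
  have hX : ∀ k, E (MvPolynomial.X k) * algebraMap (MvPolynomial (Fin 2) F) _ (MvPolynomial.X i) =
      algebraMap (MvPolynomial (Fin 2) F) _ (MvPolynomial.X k) := fun k => by
    rw [hE, dehomogenize, MvPolynomial.aeval_X]
    split_ifs with hk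
    · rw [Polynomial.eval₂_one, HomogeneousLocalization.val_one, one_mul, hk]
    · obtain rfl : k = j := by omega
      rw [Polynomial.eval₂_X, val_coordAway_mul]
  rw [← hE]
  have key : ∀ (m : Fin 2 →₀ ℕ) (c : F), m.degree = n →
      E (MvPolynomial.monomial m c) *
        algebraMap (MvPolynomial (Fin 2) F) _ (MvPolynomial.X i) ^ n =
      algebraMap (MvPolynomial (Fin 2) F) _ (MvPolynomial.monomial m c) := by
    intro m c hm
    have hm' : m 0 + m 1 = n := by
      rw [← hm, Finsupp.degree_eq_sum, Fin.sum_univ_two]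
    rw [MvPolynomial.monomial_eq, Finsupp.prod_fintype _ _ (fun _ => pow_zero _),
      Fin.prod_univ_two]
    simp only [map_mul, map_pow, hC]
    rw [← hX 0, ← hX 1, ← hm']
    ring
  conv_lhs => rw [a.as_sum, map_sum, Finset.sum_mul]
  conv_rhs => rw [a.as_sum, map_sum]
  refine Finset.sum_congr rfl fun m hm => key m _ ?_
  have := (MvPolynomial.mem_homogeneousSubmodule _ _).1 ha (MvPolynomial.mem_support_iff.1 hm)
  rw [Finsupp.degree_eq_weight_one]
  exact this

/-- The functions on the open subset `x i ≠ 0` are the polynomials in `x j / x i`, `i ≠ j`. -/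
theorem bijective_eval₂_coordAway {i j : Fin 2} (hij : i ≠ j) :
    Function.Bijective (Polynomial.eval₂RingHom (constAway F i) (coordAway F i j)) := by
  constructor
  · -- dehomogenization extends to fractions with denominators `x i ^ n`, and is a left inverse
    have hu : IsUnit (dehomogenize F i (MvPolynomial.X i)) := by
      simp [dehomogenize]
    let χ : HomogeneousLocalization.Away (lineGrading F) (MvPolynomial.X i) →+* Polynomial F :=
      (IsLocalization.Away.lift (S := Localization.Away (MvPolynomial.X (R := F) i))
        (g := (dehomogenize F i).toRingHom) (MvPolynomial.X i) hu).comp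
      (algebraMap (HomogeneousLocalization.Away (lineGrading F) (MvPolynomial.X i)) _)
    have hlift : ∀ b, IsLocalization.Away.lift (S := Localization.Away (MvPolynomial.X (R := F) i))
        (g := (dehomogenize F i).toRingHom) (MvPolynomial.X i) hu (algebraMap _ _ b) =
        dehomogenize F i b := fun b => IsLocalization.Away.lift_eq _ hu b
    have hχ : χ.comp (Polynomial.eval₂RingHom (constAway F i) (coordAway F i j)) =
        RingHom.id _ := by
      refine Polynomial.ringHom_ext (fun c => ?_) ?_
      · rw [RingHom.comp_apply, Polynomial.coe_eval₂RingHom, Polynomial.eval₂_C]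
        refine (congrArg _ (val_constAway F i c)).trans ((hlift _).trans ?_)
        simp [dehomogenize]
      · rw [RingHom.comp_apply, Polynomial.coe_eval₂RingHom, Polynomial.eval₂_X]
        have h1 := congrArg (IsLocalization.Away.lift
          (S := Localization.Away (MvPolynomial.X (R := F) i))
          (g := (dehomogenize F i).toRingHom) (MvPolynomial.X i) hu) (val_coordAway_mul F i j)
        rw [map_mul, hlift, hlift] at h1
        simp only [dehomogenize, MvPolynomial.aeval_X, if_true, if_neg hij.symm, mul_one] at h1
        exact h1
    exact Function.LeftInverse.injective (g := χ) fun P => congr($hχ P)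
  · intro z
    obtain ⟨n, a, ha, rfl⟩ := HomogeneousLocalization.Away.mk_surjective (lineGrading F)
      (X_mem_lineGrading F i) z
    refine ⟨dehomogenize F i a, HomogeneousLocalization.val_injective _ ?_⟩
    have h1 := val_eval₂_dehomogenize F hij ha
    rw [HomogeneousLocalization.Away.val_mk, Localization.mk_eq_mk']
    refine IsLocalization.eq_mk'_iff_mul_eq.2 ?_
    rw [map_pow]
    simpa using h1

/-- The open subset `x i ≠ 0` of the projective line. -/
def lineOpen (i : Fin 2) : (projectiveLine F).Opens :=
  Proj.basicOpen (lineGrading F) (MvPolynomial.X i)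

theorem isAffineOpen_lineOpen (i : Fin 2) : IsAffineOpen (lineOpen F i) :=
  Proj.isAffineOpen_basicOpen (lineGrading F) _ (X_mem_lineGrading F i) one_pos

theorem iSup_lineOpen : iSup (lineOpen F) = ⊤ := by
  refine Proj.iSup_basicOpen_eq_top' (lineGrading F) (fun i : Fin 2 => MvPolynomial.X (R := F) i)
    (fun i => ⟨1, X_mem_lineGrading F i⟩) ?_
  refine top_le_iff.1 fun p _ => ?_
  induction p using MvPolynomial.induction_on with
  | C c =>
    exact Subalgebra.algebraMap_mem _ (⟨MvPolynomial.C c, MvPolynomial.isHomogeneous_C _ c⟩ :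
      lineGrading F 0)
  | add p q hp hq => exact add_mem (hp trivial) (hq trivial)
  | mul_X p i hp => exact mul_mem (hp trivial) (Algebra.subset_adjoin ⟨i, rfl⟩)

/-- The coordinate `x j / x i` on the open subset `x i ≠ 0`. -/
def lineCoord (i j : Fin 2) : Γ(projectiveLine F, lineOpen F i) :=
  ratio (X_mem_lineGrading F i) (X_mem_lineGrading F j)

/-- The open subset `x i ≠ 0` is the affine line over `F` with coordinate `x j / x i`, `i ≠ j`. -/
theorem exists_lineChart {i j : Fin 2} (hij : i ≠ j) :
    ∃ _ : Algebra F Γ(projectiveLine F, lineOpen F i),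
      (isAffineOpen_lineOpen F i).fromSpec ≫ projectiveLineToSpec F =
        Spec.map (CommRingCat.ofHom (algebraMap F Γ(projectiveLine F, lineOpen F i))) ∧
      Function.Bijective (Polynomial.aeval (R := F) (lineCoord F i j)) := by
  refine ⟨((Proj.awayToSection (lineGrading F) (MvPolynomial.X i)).hom.comp
    (constAway F i)).toAlgebra, ?_, ?_⟩
  · have h1 := fromSpec_basicOpen_toSpecZero (lineGrading F) (X_mem_lineGrading F i) one_pos
    change (Proj.isAffineOpen_basicOpen (lineGrading F) _ (X_mem_lineGrading F i) one_pos).fromSpec ≫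
      Proj.toSpecZero (lineGrading F) ≫ _ = _
    rw [← Category.assoc, h1, ← Spec.map_comp]
    rfl
  · have h1 : Function.Bijective (Proj.awayToSection (lineGrading F) (MvPolynomial.X i)).hom :=
      (ConcreteCategory.isIso_iff_bijective _).1
        (Proj.basicOpenIsoAway (lineGrading F) _ (X_mem_lineGrading F i) one_pos).isIso_hom
    have h2 := h1.comp (bijective_eval₂_coordAway F hij)
    exact (congrArg Function.Bijective (funext fun P =>
      Polynomial.hom_eval₂ P (constAway F i)
        (Proj.awayToSection (lineGrading F) (MvPolynomial.X i)).hom (coordAway F i j))).mp h2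

end Chart

/-! ### Calculus modulo squares -/

section SquareZero

variable {B : Type*} [CommRing B] {R L R' L' : B}

/-- The power rule `R ^ (m + 1) = L ^ (m + 1) + (m + 1) L ^ m dL`, where `dL = R - L`. -/
theorem pow_succ_of_sq_sub_eq_zero (h : (R - L) * (R - L) = 0) (m : ℕ) :
    R ^ (m + 1) = L ^ m * (L + (m + 1 : ℕ) * (R - L)) := by
  induction m with
  | zero => simp
  | succ m ih =>
    rw [pow_succ, ih]
    push_cast
    linear_combination L ^ m * (m + 1) * h

theorem pow_eq_pow_of_natCast_eq_zero (h : (R - L) * (R - L) = 0) {n : ℕ} (hn : 1 ≤ n)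
    (h0 : (n : B) = 0) : L ^ n = R ^ n := by
  obtain ⟨m, rfl⟩ := Nat.exists_eq_add_of_le' hn
  rw [pow_succ_of_sq_sub_eq_zero h, h0]
  ring

theorem sub_mul_pow_of_sq_sub_eq_zero (h : (R - L) * (R - L) = 0) (m : ℕ) :
    (R - L) * R ^ m = (R - L) * L ^ m := by
  induction m with
  | zero => simp
  | succ m ih => linear_combination R * ih + L ^ m * h

/-- The differential of the inverse of a unit. -/
theorem inv_sub_inv_of_sq_sub_eq_zero (h : (R - L) * (R - L) = 0) (hR : R * R' = 1)
    (hL : L * L' = 1) : R' ^ 2 * (R - L) = -(R' - L') := by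
  linear_combination (-L' * R' ^ 2) * h + (L' * (R * R' + 1) + R' - 2 * R' * (L * L')) * hR +
    (L * R' ^ 2 - 2 * R') * hL

/-- A basis `1`, `δ` may be replaced by `1`, `c + u δ` if `u` is a unit. -/
theorem bijective_triangular {A : Type*} [CommRing A] (l : A →+* B) {δ : B}
    (h : Function.Bijective fun a : A × A => l a.1 + l a.2 * δ) {u : A} (hu : IsUnit u) (c : A) :
    Function.Bijective fun a : A × A => l a.1 * 1 + l a.2 * (l c + l u * δ) := by
  obtain ⟨v, hv⟩ := hu.exists_right_inv
  have h1 : Function.Bijective fun a : A × A => (a.1 + a.2 * c, a.2 * u) := by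
    refine Function.bijective_iff_has_inverse.2
      ⟨fun a => (a.1 - a.2 * v * c, a.2 * v), fun a => ?_, fun a => ?_⟩
    · refine Prod.ext ?_ ?_
      · change a.1 + a.2 * c - a.2 * u * v * c = a.1
        linear_combination (-a.2 * c) * hv
      · change a.2 * u * v = a.2
        linear_combination a.2 * hv
    · refine Prod.ext ?_ ?_
      · change a.1 - a.2 * v * c + a.2 * v * c = a.1
        ring
      · change a.2 * v * u = a.2
        linear_combination a.2 * hv
  convert h.comp h1 using 1
  funext a
  simp only [Function.comp_apply, map_add, map_mul]
  ring

end SquareZero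

/-! ### Splittings from compatible local bases -/

theorem IsGenerator.res {X : Scheme.{u}} {M : X.Modules} {U V : X.Opens} {e : Γ(M, U)}
    (he : IsGenerator M e) (h : V ≤ U) : IsGenerator M (res M h e) := fun W hW => by
  have := he W (hW.trans h)
  simpa only [res_res] using this

/-- Transition functions pull back. -/
theorem res_pullbackSection_of_smul {X Y : Scheme.{u}} (f : Y ⟶ X) (L : X.Modules)
    {U U' W : X.Opens} (h : W ≤ U) (h' : W ≤ U') {e : Γ(L, U)} {e' : Γ(L, U')} {a : Γ(X, W)}
    (ha : res L h' e' = a • res L h e) {V : Y.Opens} (hV : V ≤ f ⁻¹ᵁ W) :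
    res ((Scheme.Modules.pullback f).obj L) (hV.trans (f.preimage_mono h'))
        (pullbackSection f L e') =
      (f.appLE W V hV).hom a • res ((Scheme.Modules.pullback f).obj L)
        (hV.trans (f.preimage_mono h)) (pullbackSection f L e) := by
  have h1 := congrArg (fun z => res ((Scheme.Modules.pullback f).obj L) hV (pullbackSection f L z))
    ha
  simp only [pullbackSection_smul, pullbackSection_res, res_res] at h1
  rw [h1, res_smul, res_res]
  rfl

section Frames

attribute [local instance] MvPolynomial.gradedAlgebra

variable (F : Type u) [Field F] (n : ℕ)

/-- The generator `x i ^ d` of `O(d)` on the open subset `x i ≠ 0` of the projective line. -/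
def linePow (d : ℤ) (i : Fin 2) : Γ(lineTwist F d, lineOpen F i) :=
  twistPow (X_mem_lineGrading F i) d

theorem isGenerator_linePow (d : ℤ) (i : Fin 2) : IsGenerator (lineTwist F d) (linePow F d i) :=
  isGenerator_twistPow _ _

/-- On the overlap of the charts `x 1 / x 0` is a unit, and its powers are the transition functions of
the sheaves `O(d)`. -/
theorem exists_transition {W : (projectiveLine F).Opens} (h0 : W ≤ lineOpen F 0)
    (h1 : W ≤ lineOpen F 1) :
    ∃ T : Γ(projectiveLine F, W)ˣ,
      (T : Γ(projectiveLine F, W)) = resO (projectiveLine F) h0 (lineCoord F 0 1) ∧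
      (↑T⁻¹ : Γ(projectiveLine F, W)) = resO (projectiveLine F) h1 (lineCoord F 1 0) ∧
      ∀ d : ℤ, res (lineTwist F d) h1 (linePow F d 1) =
        ((T ^ d : Γ(projectiveLine F, W)ˣ) : Γ(projectiveLine F, W)) •
          res (lineTwist F d) h0 (linePow F d 0) := by
  have h := ratio_mul_ratio (X_mem_lineGrading F 0) (X_mem_lineGrading F 1) h0 h1
  exact ⟨⟨_, _, h, (mul_comm _ _).trans h⟩, rfl, rfl,
    fun d => res_twistPow (X_mem_lineGrading F 0) (X_mem_lineGrading F 1) h0 h1 _ rfl d⟩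

/-- The first-order neighbourhood of the diagonal of the projective line. -/
abbrev lineNbhd : Scheme.{u} := diagonalNeighborhood (projectiveLineToSpec F) 1

/-- The part of `X^1` over an open subset of the projective line. -/
abbrev lineNbhdOpen (U : (projectiveLine F).Opens) : (lineNbhd F).Opens :=
  firstProj (projectiveLineToSpec F) 1 ⁻¹ᵁ U

/-- The inverse image of `O(n)` under the second projection `X^1 ⟶ P¹`. -/
abbrev lineNbhdModule : (lineNbhd F).Modules :=
  principalPartsOnNeighborhood (projectiveLineToSpec F) 1 (lineTwist F n)

/-- The generator `1 ⊗ x i ^ n` of the inverse image of `O(n)`. -/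
def lineNbhdGen (i : Fin 2) : Γ(lineNbhdModule F n, lineNbhdOpen F (lineOpen F i)) :=
  res (lineNbhdModule F n) (preimage_firstProj_eq _ _).le
    (pullbackSection (secondProj (projectiveLineToSpec F) 1) (lineTwist F n) (linePow F n i))

theorem isGenerator_lineNbhdGen (i : Fin 2) :
    IsGenerator (lineNbhdModule F n) (lineNbhdGen F n i) :=
  (isGenerator_pullbackSection _ _ (isGenerator_linePow F n i)).res _

theorem lineNbhdOpen_mono {V U : (projectiveLine F).Opens} (h : V ≤ U) :
    lineNbhdOpen F V ≤ lineNbhdOpen F U :=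
  (firstProj (projectiveLineToSpec F) 1).preimage_mono h

/-- The transition functions of the inverse image of `O(n)`, along the right embedding. -/
theorem res_lineNbhdGen {W : (projectiveLine F).Opens} (h0 : W ≤ lineOpen F 0)
    (h1 : W ≤ lineOpen F 1) (T : Γ(projectiveLine F, W))
    (hT : res (lineTwist F n) h1 (linePow F n 1) = T ^ n • res (lineTwist F n) h0 (linePow F n 0)) :
    res (lineNbhdModule F n) (lineNbhdOpen_mono F h1) (lineNbhdGen F n 1) =
      rightHom (projectiveLineToSpec F) W T ^ n •
        res (lineNbhdModule F n) (lineNbhdOpen_mono F h0) (lineNbhdGen F n 0) := by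
  rw [← map_pow]
  have h2 := res_pullbackSection_of_smul (secondProj (projectiveLineToSpec F) 1) (lineTwist F n)
    h0 h1 hT (preimage_firstProj_eq (projectiveLineToSpec F) W).le
  exact (res_res (lineNbhdModule F n) _ _ _).trans
    (h2.trans (congrArg _ (res_res (lineNbhdModule F n) _ _ _).symm))

variable {F n}

/-- Let `N` have the sections of the inverse image of `O(n)` over the parts of `X^1` above the open
sets of the projective line, with scalars acting through ring homomorphisms `ρ`, as the left and the
right principal parts do. Then `N` is the sum of two line bundles as soon as it has local bases
`α i ⊗ x i ^ n`, `β i ⊗ x i ^ n` that obey the transition functions of these line bundles. -/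
theorem isLocallyFree_and_nonempty_iso {N : (projectiveLine F).Modules}
    (θ : ∀ V : (projectiveLine F).Opens, Γ(N, V) ≃+ Γ(lineNbhdModule F n, lineNbhdOpen F V))
    (ρ : ∀ V : (projectiveLine F).Opens,
      Γ(projectiveLine F, V) →+* Γ(lineNbhd F, lineNbhdOpen F V))
    (hθ : ∀ (V : (projectiveLine F).Opens) (a : Γ(projectiveLine F, V)) (z : Γ(N, V)),
      θ V (a • z) = ρ V a • θ V z)
    (hres : ∀ (V U : (projectiveLine F).Opens) (h : V ≤ U) (z : Γ(N, U)),
      θ V (res N h z) = res (lineNbhdModule F n) (lineNbhdOpen_mono F h) (θ U z))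
    {d e : ℤ} (α β : ∀ i : Fin 2, Γ(lineNbhd F, lineNbhdOpen F (lineOpen F i)))
    (hα : ∀ (W : (projectiveLine F).Opens) (h0 : W ≤ lineOpen F 0) (h1 : W ≤ lineOpen F 1)
      (T : Γ(projectiveLine F, W)ˣ),
      (T : Γ(projectiveLine F, W)) = resO (projectiveLine F) h0 (lineCoord F 0 1) →
      (↑T⁻¹ : Γ(projectiveLine F, W)) = resO (projectiveLine F) h1 (lineCoord F 1 0) →
      ρ W ((T ^ d : Γ(projectiveLine F, W)ˣ) : Γ(projectiveLine F, W)) *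
        resO (lineNbhd F) (lineNbhdOpen_mono F h0) (α 0) =
      resO (lineNbhd F) (lineNbhdOpen_mono F h1) (α 1) *
        rightHom (projectiveLineToSpec F) W T ^ n)
    (hβ : ∀ (W : (projectiveLine F).Opens) (h0 : W ≤ lineOpen F 0) (h1 : W ≤ lineOpen F 1)
      (T : Γ(projectiveLine F, W)ˣ),
      (T : Γ(projectiveLine F, W)) = resO (projectiveLine F) h0 (lineCoord F 0 1) →
      (↑T⁻¹ : Γ(projectiveLine F, W)) = resO (projectiveLine F) h1 (lineCoord F 1 0) →
      ρ W ((T ^ e : Γ(projectiveLine F, W)ˣ) : Γ(projectiveLine F, W)) *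
        resO (lineNbhd F) (lineNbhdOpen_mono F h0) (β 0) =
      resO (lineNbhd F) (lineNbhdOpen_mono F h1) (β 1) *
        rightHom (projectiveLineToSpec F) W T ^ n)
    (hb : ∀ (i : Fin 2) (g : Γ(projectiveLine F, lineOpen F i)),
      Function.Bijective fun a : Γ(projectiveLine F, (projectiveLine F).basicOpen g) ×
          Γ(projectiveLine F, (projectiveLine F).basicOpen g) =>
        ρ _ a.1 * resO (lineNbhd F)
          (lineNbhdOpen_mono F ((projectiveLine F).basicOpen_le g)) (α i) +
        ρ _ a.2 * resO (lineNbhd F)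
          (lineNbhdOpen_mono F ((projectiveLine F).basicOpen_le g)) (β i)) :
    IsLocallyFree N ∧ Nonempty (N ≅ lineTwist F d ⊞ lineTwist F e) := by
  have key : ∀ (d : ℤ) (γ : ∀ i : Fin 2, Γ(lineNbhd F, lineNbhdOpen F (lineOpen F i))),
      (∀ (W : (projectiveLine F).Opens) (h0 : W ≤ lineOpen F 0) (h1 : W ≤ lineOpen F 1)
      (T : Γ(projectiveLine F, W)ˣ),
      (T : Γ(projectiveLine F, W)) = resO (projectiveLine F) h0 (lineCoord F 0 1) →
      (↑T⁻¹ : Γ(projectiveLine F, W)) = resO (projectiveLine F) h1 (lineCoord F 1 0) →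
      ρ W ((T ^ d : Γ(projectiveLine F, W)ˣ) : Γ(projectiveLine F, W)) *
        resO (lineNbhd F) (lineNbhdOpen_mono F h0) (γ 0) =
      resO (lineNbhd F) (lineNbhdOpen_mono F h1) (γ 1) *
        rightHom (projectiveLineToSpec F) W T ^ n) →
      ∃ φ : lineTwist F d ⟶ N, ∀ i,
        φ.app (lineOpen F i) (linePow F d i) = (θ _).symm (γ i • lineNbhdGen F n i) := by
    intro d γ hγ
    have h01 : ∀ (W : (projectiveLine F).Opens) (h0 : W ≤ lineOpen F 0) (h1 : W ≤ lineOpen F 1)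
        (a b : Γ(projectiveLine F, W)),
        a • res (lineTwist F d) h0 (linePow F d 0) = b • res (lineTwist F d) h1 (linePow F d 1) →
        a • res N h0 ((θ _).symm (γ 0 • lineNbhdGen F n 0)) =
          b • res N h1 ((θ _).symm (γ 1 • lineNbhdGen F n 1)) := by
      intro W h0 h1 a b hab
      obtain ⟨T, hT, hT', htr⟩ := exists_transition F h0 h1
      rw [htr, ← mul_smul] at hab
      have h2 := (isGenerator_linePow F d 0 W h0).1 hab
      have h3 := htr n
      rw [zpow_natCast, Units.val_pow_eq_pow_val] at h3
      apply (θ W).injective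
      rw [hθ, hθ, hres, hres, AddEquiv.apply_symm_apply, AddEquiv.apply_symm_apply, res_smul,
        res_smul, res_lineNbhdGen F n h0 h1 T h3, ← mul_smul, ← mul_smul, ← mul_smul, h2, map_mul,
        mul_assoc, hγ W h0 h1 T hT hT', mul_assoc (ρ W b)]
    refine exists_hom_of_isGenerator (lineOpen F) (iSup_lineOpen F) (linePow F d)
      (isGenerator_linePow F d) (fun i => (θ _).symm (γ i • lineNbhdGen F n i)) ?_
    intro i j W hi hj a b hab
    have hii : i = j → a • res N hi ((θ _).symm (γ i • lineNbhdGen F n i)) =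
        b • res N hj ((θ _).symm (γ j • lineNbhdGen F n j)) := by
      rintro rfl
      obtain rfl := (isGenerator_linePow F d i W hi).1 hab
      rfl
    match i, j with
    | 0, 0 => exact hii rfl
    | 1, 1 => exact hii rfl
    | 0, 1 => exact h01 W hi hj a b hab
    | 1, 0 => exact (h01 W hj hi b a hab.symm).symm
  obtain ⟨φ, hφ⟩ := key d α hα
  obtain ⟨ψ, hψ⟩ := key e β hβ
  have hiso : IsIso (biprod.desc φ ψ) := by
    refine isIso_biprod_desc φ ψ fun x W hx => ?_
    have hcov : x ∈ iSup (lineOpen F) := by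
      rw [iSup_lineOpen]
      trivial
    obtain ⟨i, hi⟩ := Opens.mem_iSup.1 hcov
    obtain ⟨g, hgW, hgx⟩ := (isAffineOpen_lineOpen F i).exists_basicOpen_le ⟨x, hx⟩ hi
    have hV := (projectiveLine F).basicOpen_le g
    refine ⟨(projectiveLine F).basicOpen g, res _ hV (linePow F d i), res _ hV (linePow F e i), hgx,
      hgW, (isGenerator_linePow F d i).res hV, (isGenerator_linePow F e i).res hV, ?_⟩
    refine (Function.Bijective.of_comp_iff' (θ _).bijective _).1 ?_
    convert (isGenerator_lineNbhdGen F n i _ (lineNbhdOpen_mono F hV)).comp (hb i g) using 1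
    funext a
    simp only [Function.comp_apply, map_add, hθ, app_res, hφ, hψ, hres, AddEquiv.apply_symm_apply,
      res_smul, add_smul, mul_smul]
  have i : N ≅ lineTwist F d ⊞ lineTwist F e := (asIso (biprod.desc φ ψ)).symm
  refine ⟨?_, ⟨i⟩⟩
  refine isLocallyFree_of_iso_biprod i (fun j : ULift.{u} (Fin 2) => lineOpen F j.down) ?_
    (fun j => linePow F d j.down) (fun j => isGenerator_linePow F d j.down)
    (fun j => linePow F e j.down) (fun j => isGenerator_linePow F e j.down)
  rw [← iSup_lineOpen F]
  exact Equiv.ulift.iSup_comp (g := lineOpen F)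

end Frames

/-! ### The splittings of the principal parts -/

theorem pushforward_smul {X Y : Scheme.{u}} (f : Y ⟶ X) (G : Y.Modules) (U : X.Opens) (a : Γ(X, U))
    (z : Γ((Scheme.Modules.pushforward f).obj G, U)) :
    (a • z : Γ((Scheme.Modules.pushforward f).obj G, U)) =
      ((f.app U).hom a • (show Γ(G, f ⁻¹ᵁ U) from z) : Γ(G, f ⁻¹ᵁ U)) := rfl

section Splitting

attribute [local instance] MvPolynomial.gradedAlgebra

variable (F : Type u) [Field F]

theorem lineDiff_mul_lineDiff {i : Fin 2} {W : (projectiveLine F).Opens} (h : W ≤ lineOpen F i)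
    (a b : Γ(projectiveLine F, lineOpen F i)) :
    diff (projectiveLineToSpec F) (resO (projectiveLine F) h a) *
      diff (projectiveLineToSpec F) (resO (projectiveLine F) h b) = 0 := by
  obtain ⟨j, hj⟩ : ∃ j, i ≠ j := ⟨i + 1, by omega⟩
  obtain ⟨_, hf, -⟩ := exists_lineChart F hj
  rw [diff_resO, diff_resO, ← map_mul, diff_mul_diff _ (isAffineOpen_lineOpen F i) hf, map_zero]

theorem bijective_line_leftHom {i j : Fin 2} (hij : i ≠ j)
    (g : Γ(projectiveLine F, lineOpen F i)) :
    Function.Bijective fun a : Γ(projectiveLine F, (projectiveLine F).basicOpen g) ×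
        Γ(projectiveLine F, (projectiveLine F).basicOpen g) =>
      leftHom (projectiveLineToSpec F) _ a.1 + leftHom (projectiveLineToSpec F) _ a.2 *
        diff (projectiveLineToSpec F) (resO _ ((projectiveLine F).basicOpen_le g)
          (lineCoord F i j)) := by
  obtain ⟨_, hf, ht⟩ := exists_lineChart F hij
  exact bijective_leftHom _ (isAffineOpen_lineOpen F i) hf ht g

theorem bijective_line_rightHom {i j : Fin 2} (hij : i ≠ j)
    (g : Γ(projectiveLine F, lineOpen F i)) :
    Function.Bijective fun a : Γ(projectiveLine F, (projectiveLine F).basicOpen g) ×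
        Γ(projectiveLine F, (projectiveLine F).basicOpen g) =>
      rightHom (projectiveLineToSpec F) _ a.1 + rightHom (projectiveLineToSpec F) _ a.2 *
        diff (projectiveLineToSpec F) (resO _ ((projectiveLine F).basicOpen_le g)
          (lineCoord F i j)) := by
  obtain ⟨_, hf, ht⟩ := exists_lineChart F hij
  exact bijective_rightHom _ (isAffineOpen_lineOpen F i) hf ht g

variable {F}

theorem isUnit_natCast_of_le_lineOpen {i : Fin 2} {W : (projectiveLine F).Opens}
    (h : W ≤ lineOpen F i) {n : ℕ} (hn : (n : F) ≠ 0) : IsUnit (n : Γ(projectiveLine F, W)) := by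
  obtain ⟨j, hj⟩ : ∃ j, i ≠ j := ⟨i + 1, by omega⟩
  obtain ⟨_, -, -⟩ := exists_lineChart F hj
  have := (isUnit_iff_ne_zero.2 hn).map
    ((resO (projectiveLine F) h).comp (algebraMap F Γ(projectiveLine F, lineOpen F i)))
  rwa [map_natCast] at this

theorem natCast_eq_zero_of_le_lineOpen {i : Fin 2} {W : (projectiveLine F).Opens}
    (h : W ≤ lineOpen F i) {n : ℕ} (hn : (n : F) = 0) : (n : Γ(projectiveLine F, W)) = 0 := by
  obtain ⟨j, hj⟩ : ∃ j, i ≠ j := ⟨i + 1, by omega⟩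
  obtain ⟨_, -, -⟩ := exists_lineChart F hj
  have := congrArg
    ((resO (projectiveLine F) h).comp (algebraMap F Γ(projectiveLine F, lineOpen F i))) hn
  rwa [map_natCast, map_zero] at this

/-- On the overlap of the two charts: the values `R`, `L` of `x 1 / x 0` under the right and left
embeddings, their inverses `R'`, `L'`, and the differentials of the two coordinates. -/
theorem overlap_relations {W : (projectiveLine F).Opens} (h0 : W ≤ lineOpen F 0)
    (h1 : W ≤ lineOpen F 1) (T : Γ(projectiveLine F, W)ˣ)
    (hT : (T : Γ(projectiveLine F, W)) = resO (projectiveLine F) h0 (lineCoord F 0 1))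
    (hT' : (↑T⁻¹ : Γ(projectiveLine F, W)) = resO (projectiveLine F) h1 (lineCoord F 1 0)) :
    let R := rightHom (projectiveLineToSpec F) W T
    let L := leftHom (projectiveLineToSpec F) W T
    let R' := rightHom (projectiveLineToSpec F) W ↑T⁻¹
    let L' := leftHom (projectiveLineToSpec F) W ↑T⁻¹
    (R - L) * (R - L) = 0 ∧ (R' - L') * (R' - L') = 0 ∧ R * R' = 1 ∧ L * L' = 1 ∧
    resO (lineNbhd F) (lineNbhdOpen_mono F h0)
      (diff (projectiveLineToSpec F) (lineCoord F 0 1)) = R - L ∧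
    resO (lineNbhd F) (lineNbhdOpen_mono F h1)
      (diff (projectiveLineToSpec F) (lineCoord F 1 0)) = R' - L' ∧
    resO (lineNbhd F) (lineNbhdOpen_mono F h0)
      (leftHom (projectiveLineToSpec F) _ (lineCoord F 0 1)) = L ∧
    resO (lineNbhd F) (lineNbhdOpen_mono F h1)
      (leftHom (projectiveLineToSpec F) _ (lineCoord F 1 0)) = L' := by
  have e1 := lineDiff_mul_lineDiff F h0 (lineCoord F 0 1) (lineCoord F 0 1)
  have e2 := lineDiff_mul_lineDiff F h1 (lineCoord F 1 0) (lineCoord F 1 0)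
  rw [← hT] at e1
  rw [← hT'] at e2
  refine ⟨e1, e2, ?_, ?_, ?_, ?_, ?_, ?_⟩
  · rw [← map_mul, Units.mul_inv, map_one]
  · rw [← map_mul, Units.mul_inv, map_one]
  · rw [hT]
    exact (diff_resO _ h0 _).symm
  · rw [hT']
    exact (diff_resO _ h1 _).symm
  · rw [hT]
    exact (leftHom_resO _ h0 _).symm
  · rw [hT']
    exact (leftHom_resO _ h1 _).symm

theorem val_zpow_sub_two {A : Type*} [CommRing A] (T : Aˣ) (n : ℕ) :
    ((T ^ ((n : ℤ) - 2) : Aˣ) : A) = (T : A) ^ n * (↑T⁻¹ : A) ^ 2 := by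
  rw [zpow_sub, zpow_natCast, zpow_ofNat]
  simp

variable (F)

/-- The sections of the right principal parts. The restriction is along an equality of open sets,
as the two projections agree topologically. -/
def rightPartsEquiv (n : ℕ) (V : (projectiveLine F).Opens) :
    Γ(lineRightParts F 1 n, V) ≃+ Γ(lineNbhdModule F n, lineNbhdOpen F V) :=
  AddEquiv.ofBijective
    (res (lineNbhdModule F n) (preimage_firstProj_eq (projectiveLineToSpec F) V).le)
    (bijective_res_of_le _ _ (preimage_firstProj_eq (projectiveLineToSpec F) V).ge)

/-- The sections of the left principal parts. -/
def leftPartsEquiv (n : ℕ) (V : (projectiveLine F).Opens) :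
    Γ(lineLeftParts F 1 n, V) ≃+ Γ(lineNbhdModule F n, lineNbhdOpen F V) :=
  AddEquiv.refl _

theorem leftPartsEquiv_smul (n : ℕ) (V : (projectiveLine F).Opens) (a : Γ(projectiveLine F, V))
    (z : Γ(lineLeftParts F 1 n, V)) :
    leftPartsEquiv F n V (a • z) =
      leftHom (projectiveLineToSpec F) V a • leftPartsEquiv F n V z :=
  pushforward_smul (firstProj (projectiveLineToSpec F) 1) (lineNbhdModule F n) V a z

/-- The frame `d(x 1 / x 0)`, `-d(x 0 / x 1)` of the conormal module of the diagonal. -/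
def diffFrame (i : Fin 2) : Γ(lineNbhd F, lineNbhdOpen F (lineOpen F i)) :=
  match i with
  | 0 => diff (projectiveLineToSpec F) (lineCoord F 0 1)
  | 1 => -diff (projectiveLineToSpec F) (lineCoord F 1 0)

theorem bijective_diffFrame
    (ρ : ∀ V : (projectiveLine F).Opens,
      Γ(projectiveLine F, V) →+* Γ(lineNbhd F, lineNbhdOpen F V))
    (hρ : ∀ (i j : Fin 2) (_ : i ≠ j) (g : Γ(projectiveLine F, lineOpen F i)),
      Function.Bijective fun a : Γ(projectiveLine F, (projectiveLine F).basicOpen g) ×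
        Γ(projectiveLine F, (projectiveLine F).basicOpen g) =>
      ρ _ a.1 + ρ _ a.2 *
        diff (projectiveLineToSpec F) (resO _ ((projectiveLine F).basicOpen_le g)
          (lineCoord F i j))) (i : Fin 2) (g : Γ(projectiveLine F, lineOpen F i)) :
    Function.Bijective fun a : Γ(projectiveLine F, (projectiveLine F).basicOpen g) ×
          Γ(projectiveLine F, (projectiveLine F).basicOpen g) =>
        ρ _ a.1 * resO (lineNbhd F)
          (lineNbhdOpen_mono F ((projectiveLine F).basicOpen_le g)) 1 +
        ρ _ a.2 * resO (lineNbhd F)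
          (lineNbhdOpen_mono F ((projectiveLine F).basicOpen_le g)) (diffFrame F i) := by
  match i with
  | 0 =>
    have h := bijective_triangular _ (hρ 0 1 (by decide) g) isUnit_one 0
    rw [diff_resO] at h
    simpa only [diffFrame, map_one, map_zero, one_mul, zero_add] using h
  | 1 =>
    have h := bijective_triangular _ (hρ 1 0 (by decide) g) isUnit_one.neg 0
    rw [diff_resO] at h
    simpa only [diffFrame, map_one, map_neg, map_zero, neg_mul, one_mul, zero_add] using h

/-- The right module of principal parts: the basis `1 ⊗ x i ^ n`, `d(x j / x i) ⊗ x i ^ n` has a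
diagonal transition matrix. -/
theorem rightParts_iso (n : ℕ) :
    IsLocallyFree (lineRightParts F 1 n) ∧
      Nonempty (lineRightParts F 1 n ≅ lineTwist F n ⊞ lineTwist F (n - 2)) := by
  refine isLocallyFree_and_nonempty_iso (rightPartsEquiv F n)
    (rightHom (projectiveLineToSpec F)) (fun V a z => ?_) (fun V U h z => ?_)
    (fun _ => 1) (diffFrame F) ?_ ?_
    (bijective_diffFrame F _ fun i j => bijective_line_rightHom F)
  · exact res_smul (lineNbhdModule F n) _ _ z
  · exact (res_res (lineNbhdModule F n) _ _ z).trans (res_res (lineNbhdModule F n) _ _ z).symm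
  · intro W h0 h1 T hT hT'
    rw [map_one, map_one, mul_one, one_mul, zpow_natCast, Units.val_pow_eq_pow_val, map_pow]
  · intro W h0 h1 T hT hT'
    obtain ⟨e1, -, hR, hL, d0, d1, -, -⟩ := overlap_relations h0 h1 T hT hT'
    simp only [diffFrame]
    rw [map_neg, d0, d1, val_zpow_sub_two, map_mul, map_pow, map_pow]
    linear_combination rightHom (projectiveLineToSpec F) W T ^ n *
      inv_sub_inv_of_sq_sub_eq_zero e1 hR hL

/-- The left module of principal parts when `n` vanishes in `F`: the transition matrix of the basis
`1 ⊗ x i ^ n`, `d(x j / x i) ⊗ x i ^ n` is diagonal, because `n` is its only entry off the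
diagonal up to units. -/
theorem leftParts_iso_of_natCast_eq_zero (n : ℕ) (hn : 1 ≤ n) (h : (n : F) = 0) :
    IsLocallyFree (lineLeftParts F 1 n) ∧
      Nonempty (lineLeftParts F 1 n ≅ lineTwist F n ⊞ lineTwist F (n - 2)) := by
  refine isLocallyFree_and_nonempty_iso (leftPartsEquiv F n)
    (leftHom (projectiveLineToSpec F)) (leftPartsEquiv_smul F n) (fun V U h z => rfl)
    (fun _ => 1) (diffFrame F) ?_ ?_
    (bijective_diffFrame F _ fun i j => bijective_line_leftHom F)
  · intro W h0 h1 T hT hT'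
    obtain ⟨e1, -⟩ := overlap_relations h0 h1 T hT hT'
    have hn0 : (n : Γ(lineNbhd F, lineNbhdOpen F W)) = 0 := by
      have := congrArg (leftHom (projectiveLineToSpec F) W) (natCast_eq_zero_of_le_lineOpen h0 h)
      rwa [map_natCast, map_zero] at this
    rw [map_one, map_one, mul_one, one_mul, zpow_natCast, Units.val_pow_eq_pow_val, map_pow]
    exact pow_eq_pow_of_natCast_eq_zero e1 hn hn0
  · intro W h0 h1 T hT hT'
    obtain ⟨e1, -, hR, hL, d0, d1, -, -⟩ := overlap_relations h0 h1 T hT hT'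
    simp only [diffFrame]
    rw [map_neg, d0, d1, val_zpow_sub_two, map_mul, map_pow, map_pow]
    have e2 := inv_sub_inv_of_sq_sub_eq_zero (R := leftHom (projectiveLineToSpec F) W T)
      (L := rightHom (projectiveLineToSpec F) W T) (by linear_combination e1) hL hR
    have e3 := sub_mul_pow_of_sq_sub_eq_zero e1 n
    linear_combination -(rightHom (projectiveLineToSpec F) W T ^ n) * e2 -
      leftHom (projectiveLineToSpec F) W ↑T⁻¹ ^ 2 * e3

/-- The family `a`, `b` of functions on the parts of `X^1` over the two charts. -/
def chartFamily (a : Γ(lineNbhd F, lineNbhdOpen F (lineOpen F 0)))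
    (b : Γ(lineNbhd F, lineNbhdOpen F (lineOpen F 1))) (i : Fin 2) :
    Γ(lineNbhd F, lineNbhdOpen F (lineOpen F i)) :=
  match i with
  | 0 => a
  | 1 => b

/-- The coefficient `t + n dt` where `t = x j / x i`. -/
def shiftedCoord (n : ℕ) (i j : Fin 2) : Γ(lineNbhd F, lineNbhdOpen F (lineOpen F i)) :=
  leftHom (projectiveLineToSpec F) _ (lineCoord F i j) +
    n * diff (projectiveLineToSpec F) (lineCoord F i j)

theorem bijective_shiftedCoord {n : ℕ} (h : (n : F) ≠ 0) {i j : Fin 2} (hij : i ≠ j)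
    (g : Γ(projectiveLine F, lineOpen F i)) :
    Function.Bijective fun a : Γ(projectiveLine F, (projectiveLine F).basicOpen g) ×
          Γ(projectiveLine F, (projectiveLine F).basicOpen g) =>
      leftHom (projectiveLineToSpec F) _ a.1 * resO (lineNbhd F)
          (lineNbhdOpen_mono F ((projectiveLine F).basicOpen_le g)) 1 +
        leftHom (projectiveLineToSpec F) _ a.2 * resO (lineNbhd F)
          (lineNbhdOpen_mono F ((projectiveLine F).basicOpen_le g)) (shiftedCoord F n i j) := by
  have h1 := bijective_triangular _ (bijective_line_leftHom F hij g)
    (isUnit_natCast_of_le_lineOpen ((projectiveLine F).basicOpen_le g) h)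
    (resO _ ((projectiveLine F).basicOpen_le g) (lineCoord F i j))
  rw [diff_resO, leftHom_resO] at h1
  simpa only [shiftedCoord, map_one, map_add, map_mul, map_natCast] using h1

/-- The left module of principal parts when `n` is invertible in `F`. With `t = x 1 / x 0` and
`s = x 0 / x 1`, the bases `(t + n dt) ⊗ x 0 ^ n`, `1 ⊗ x 0 ^ n` and `1 ⊗ x 1 ^ n`,
`(s + n ds) ⊗ x 1 ^ n` over the two charts correspond under `t ^ (n - 1)`, by the power rule for `t`
and for `s`. They are bases because `n` is a unit. -/
theorem leftParts_iso_of_natCast_ne_zero (n : ℕ) (hn : 1 ≤ n) (h : (n : F) ≠ 0) :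
    IsLocallyFree (lineLeftParts F 1 n) ∧
      Nonempty (lineLeftParts F 1 n ≅ lineTwist F (n - 1) ⊞ lineTwist F (n - 1)) := by
  refine isLocallyFree_and_nonempty_iso (leftPartsEquiv F n)
    (leftHom (projectiveLineToSpec F)) (leftPartsEquiv_smul F n) (fun V U h z => rfl)
    (chartFamily F (shiftedCoord F n 0 1) 1) (chartFamily F 1 (shiftedCoord F n 1 0)) ?_ ?_ ?_
  · intro W h0 h1 T hT hT'
    obtain ⟨e1, -, -, -, d0, -, c0, -⟩ := overlap_relations h0 h1 T hT hT'
    obtain ⟨m, rfl⟩ := Nat.exists_eq_add_of_le' hn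
    have e2 := pow_succ_of_sq_sub_eq_zero e1 m
    simp only [chartFamily, shiftedCoord]
    rw [map_add, map_mul, map_natCast, c0, d0, map_one, one_mul, e2, Nat.cast_succ,
      add_sub_cancel_right, zpow_natCast, Units.val_pow_eq_pow_val, map_pow]
  · intro W h0 h1 T hT hT'
    obtain ⟨-, e1, hR, hL, -, d1, -, c1⟩ := overlap_relations h0 h1 T hT hT'
    obtain ⟨m, rfl⟩ := Nat.exists_eq_add_of_le' hn
    have e2 := pow_succ_of_sq_sub_eq_zero e1 m
    have hR' := congrArg (· ^ (m + 1)) hR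
    have hL' := congrArg (· ^ m) hL
    simp only [mul_pow, one_pow] at hR' hL'
    simp only [chartFamily, shiftedCoord]
    rw [map_add, map_mul, map_natCast, c1, d1, map_one, mul_one, Nat.cast_succ (R := ℤ),
      add_sub_cancel_right, zpow_natCast, Units.val_pow_eq_pow_val, map_pow]
    generalize rightHom (projectiveLineToSpec F) W T = R at *
    generalize leftHom (projectiveLineToSpec F) W T = L at *
    generalize rightHom (projectiveLineToSpec F) W ↑T⁻¹ = R' at *
    generalize leftHom (projectiveLineToSpec F) W ↑T⁻¹ = L' at *
    linear_combination -(L ^ m) * hR' + L ^ m * R ^ (m + 1) * e2 +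
      R ^ (m + 1) * (L' + (m + 1 : ℕ) * (R' - L')) * hL'
  · intro i g
    match i with
    | 0 =>
      convert (bijective_shiftedCoord F h (i := 0) (j := 1) (by decide) g).comp
        Prod.swap_bijective using 1
      funext a
      exact add_comm _ _
    | 1 => exact bijective_shiftedCoord F h (i := 1) (j := 0) (by decide) g

end Splitting

end PrincipalParts

end

theorem theorem6p1 (F : Type u) [Field F] (n : ℕ) (hn : 1 ≤ n) :
    PrincipalParts.IsLocallyFree (PrincipalParts.lineLeftParts F 1 n) ∧
    PrincipalParts.IsLocallyFree (PrincipalParts.lineRightParts F 1 n) ∧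
    Nonempty (PrincipalParts.lineRightParts F 1 n ≅
      PrincipalParts.lineTwist F n ⊞ PrincipalParts.lineTwist F (n - 2)) ∧
    (¬ ringChar F ∣ n →
      Nonempty (PrincipalParts.lineLeftParts F 1 n ≅
        PrincipalParts.lineTwist F (n - 1) ⊞ PrincipalParts.lineTwist F (n - 1))) ∧
    (ringChar F ∣ n →
      Nonempty (PrincipalParts.lineLeftParts F 1 n ≅
        PrincipalParts.lineTwist F n ⊞ PrincipalParts.lineTwist F (n - 2))) := by
  obtain ⟨hr, hr'⟩ := PrincipalParts.rightParts_iso F n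
  by_cases h : ringChar F ∣ n
  · obtain ⟨hl, hl'⟩ :=
      PrincipalParts.leftParts_iso_of_natCast_eq_zero F n hn ((ringChar.spec F n).2 h)
    exact ⟨hl, hr, hr', fun h' => absurd h h', fun _ => hl'⟩
  · obtain ⟨hl, hl'⟩ :=
      PrincipalParts.leftParts_iso_of_natCast_ne_zero F n hn (mt (ringChar.spec F n).1 h)
    exact ⟨hl, hr, hr', fun _ => hl', fun h' => absurd h' h⟩
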